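/- Let $\mu\neq 0$ be a real (signed) finite Borel measure on $(0,\infty)$ with $\mu((0,\infty))=0$, and let $F(z)=\int_0^\infty e^{-z\xi}\,d\mu(\xi)$ $(\operatorname{Re} z\ge 0)$ be its Laplace transform. Let $X$ be a complex Banach space and let $(T(t))_{t>0}$ be a semigroup of bounded operators on $X$ (that is, $T(s+t)=T(s)T(t)$ for all $s,t>0$) such that $t\mapsto T(t)x$ is continuous on $(0,\infty)$ for every $x\in X$, every $T(t)$ has spectral radius $0$, and $T(t)\ne 0$ for some $t>0$. Write $A$ for its generator and, for $s>0$, let $$F(-sA)x=\int_0^\infty T(s\xi)x\,d\mu(\xi)\qquad(x\in X),$$ where $F(-sA)$ is said to be defined if this Bochner integral exists (with respect to $|\mu|$) for every $x\in X$. (a) If $|\mu|((0,a))=0$ for some $a>0$ (in particular, if $\mu$ has compact support in $(0,\infty)$), or if $\sup_{0<t<a}\|T(t)\|<\infty$ for some $a>0$, then $F(-sA)$ is defined for every $s>0$. (b) The maximum $\max_{x\ge 0}|F(x)|$ is attained, and there exists $\eta>0$ such that for every $s\in(0,\eta]$ for which $F(-sA)$ is defined, $F(-sA)$ is a bounded linear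 operator on $X$ and $$\|F(-sA)\|>\max_{x\ge 0}|F(x)| .$$ -/

import Mathlib

open MeasureTheory Set

noncomputable section

/-- The Laplace transform `z ↦ ∫ e^{-zξ} dμ(ξ)` of a real finite Borel measure `μ` on `(0, ∞)`. -/
def laplaceTransform (μ : SignedMeasure (Ioi (0 : ℝ))) (z : ℂ) : ℂ :=
  ∫ᵛ ξ : Ioi (0 : ℝ), Complex.exp (-(z * ((ξ : ℝ) : ℂ))) ∂<•μ

variable {X : Type*} [NormedAddCommGroup X] [NormedSpace ℂ X]

/-- `(T(t))_{t > 0}` is a semigroup of bounded operators which is strongly continuous on `(0, ∞)`.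
Nothing is required at the origin, and the values of `T` at `t ≤ 0` play no role. -/
structure IsStronglyContinuousSemigroup (T : ℝ → X →L[ℂ] X) : Prop where
  map_add : ∀ s t : ℝ, 0 < s → 0 < t → T (s + t) = T s * T t
  continuousOn : ∀ x : X, ContinuousOn (fun t : ℝ => T t x) (Ioi 0)

/-- Every element of the semigroup has spectral radius `0`. -/
def IsQuasinilpotentSemigroup (T : ℝ → X →L[ℂ] X) : Prop :=
  ∀ t : ℝ, 0 < t → spectralRadius ℂ (T t) = 0

/-- The Bochner integrals `∫ T(sξ)x dμ(ξ)` that define `F(-sA)` exist for all `x`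
(`μ.Integrable f` is Bochner integrability of `f` with respect to the variation `|μ|`). -/
def IsFunctionalCalculusDefined (μ : SignedMeasure (Ioi (0 : ℝ))) (T : ℝ → X →L[ℂ] X)
    (s : ℝ) : Prop :=
  ∀ x : X, μ.Integrable (fun ξ : Ioi (0 : ℝ) => T (s * (ξ : ℝ)) x)

/-- The map `F(-sA) : x ↦ ∫ T(sξ)x dμ(ξ)`, where `F` is the Laplace transform of `μ` and `A` is
the generator of `T` (so that `sA` is the generator of `t ↦ T(st)`). -/
def functionalCalculus (μ : SignedMeasure (Ioi (0 : ℝ))) (T : ℝ → X →L[ℂ] X) (s : ℝ) (x : X) : X :=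
  ∫ᵛ ξ : Ioi (0 : ℝ), T (s * (ξ : ℝ)) x ∂<•μ

end

/-!
Fix an orbit `t ↦ T (t + a) x`. Since `T` is quasinilpotent, `J z = ∫₀^∞ e^{zt} T (t + a) x dt` is
an entire function, bounded for `Re z ≤ 0`, and for `Re z ≥ 0` the operator `F(-sA)` acts on `J z`
as multiplication by `F(sz)`, up to an error bounded uniformly in `s` and `z`. Hence if
`‖F(-sA)‖ ≤ M = max |F|`, then `‖J z‖ (|F(sz)| - M)` is bounded independently of `s`.

Let `|F|` attain its maximum over `[0, ∞)` at `x₀ > 0`. By the local expansion of `F` at `x₀` and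
the maximum principle, `|F| > M` along a curve which starts at `x₀` and reaches the imaginary axis.
Together with its reflection in the real axis, this curve encloses a half-disc at `0`. The maximum
principle for `(w - x₀)^m J(w / s)`, whose factor `(w - x₀)^m` compensates for `|F| - M` vanishing
at `x₀`, bounds `J` on a half-disc of radius proportional to `1 / s`. If this happens for
arbitrarily small `s`, then `J` is bounded on `ℂ`, so it is constant by Liouville's theorem, in fact
`0`, and Fourier inversion gives `T = 0`.
-/

open Complex Filter Metric Topology
open scoped ComplexConjugate

section Crossing

theorem notMem_of_mem_frontier_connectedComponentIn {α : Type*} [TopologicalSpace α]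
    [LocallyConnectedSpace α] {U : Set α} (hU : IsOpen U) {x w : α}
    (hw : w ∈ frontier (connectedComponentIn U x)) : w ∉ U := by
  intro hwU
  obtain ⟨y, hyw, hyx⟩ :=
    mem_closure_iff.1 hw.1 _ hU.connectedComponentIn (mem_connectedComponentIn hwU)
  have hwx : connectedComponentIn U w = connectedComponentIn U x :=
    (connectedComponentIn_eq hyw).trans (connectedComponentIn_eq hyx).symm
  exact (hU.connectedComponentIn.frontier_eq.le hw).2 (hwx ▸ mem_connectedComponentIn hwU)

theorem sub_eq_log_sub_log_of_exp_eq {α : Type*} [TopologicalSpace α] [PreconnectedSpace α]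
    {f g : α → ℂ} {c : ℂ} (hf : Continuous f) (hg : Continuous g) (hfg : ∀ q, exp (f q) = g q)
    (hc : ∀ q, c * g q ∈ slitPlane) (q q' : α) :
    f q - f q' = log (c * g q) - log (c * g q') := by
  have hexp : ∀ q, exp (f q - log (c * g q)) = c⁻¹ := fun q ↦ by
    have hne := slitPlane_ne_zero (hc q)
    rw [exp_sub, exp_log hne, hfg]
    field_simp [left_ne_zero_of_mul hne, right_ne_zero_of_mul hne]
  have hconst : f q - log (c * g q) = f q' - log (c * g q') :=
    isCoveringMap_exp.const_of_comp (hf.sub ((continuous_const.mul hg).clog hc))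
      (fun a a' ↦ Subtype.ext ((hexp a).trans (hexp a').symm)) q q'
  linear_combination hconst

theorem log_mul_ofReal_im_sub_eq_pi {c : ℂ} (hc : 0 < c.im) {s t : ℝ} (hs : 0 < s) (ht : t < 0) :
    (log (c * s)).im - (log (c * t)).im = Real.pi := by
  have hneg : c * (t : ℂ) = (-t : ℝ) * -c := by push_cast; ring
  rw [log_im, log_im, mul_comm, arg_real_mul _ hs, hneg, arg_real_mul _ (neg_pos.2 ht),
    arg_neg_eq_arg_sub_pi_of_im_pos hc]
  ring

theorem one_add_I_mul_mem_slitPlane {z : ℂ} (hz : z ≠ 0) (h : 0 < z.re ∨ z.im ≤ 0) :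
    (1 + I) * z ∈ slitPlane := by
  rw [mem_slitPlane_iff]
  contrapose! hz
  simp only [mul_re, add_re, one_re, I_re, add_zero, one_mul, add_im, one_im, I_im, zero_add,
    tsub_le_iff_right, mul_im] at hz
  apply Complex.ext <;> rcases h with h | h <;> simp <;> linarith

theorem neg_I_mul_mem_slitPlane {z : ℂ} (hz : z ≠ 0) (h : 0 ≤ z.im) : -I * z ∈ slitPlane := by
  rw [mem_slitPlane_iff]
  contrapose! hz
  simp only [neg_mul, neg_re, mul_re, I_re, zero_mul, I_im, one_mul, zero_sub, neg_neg, neg_im,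
    mul_im, zero_add, neg_eq_zero] at hz
  apply Complex.ext <;> simp <;> linarith

theorem exists_eq_of_crossing {p γ : ℝ → ℂ} (hp : Continuous p) (hγ : Continuous γ)
    {a b x₀ y₀ : ℝ} (hax : a < x₀) (hxb : x₀ < b)
    (hp0 : p 0 = a) (hp1 : p 1 = b) (hγ0 : γ 0 = y₀ * I) (hγ1 : γ 1 = x₀)
    (hpim : ∀ s, 0 ≤ (p s).im) (hpre : ∀ s, 0 < (p s).re) (hγim : ∀ s, 0 ≤ (γ s).im) :
    ∃ s t, p s = γ t := by
  by_contra! hne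
  -- On the edges `t = 0`, `s = 0` and `s = 1` of the unit square, `p s - γ t` has a logarithm with
  -- the branch cut rotated by `1 + I`; on the edge `t = 1` it has one rotated by `-I`. The two
  -- resulting values for the change of argument along the boundary from `(0, 1)` to `(1, 1)` are
  -- `π` and `-π`.
  replace hne : ∀ s t, p s - γ t ≠ 0 := fun s t ↦ sub_ne_zero.2 (hne s t)
  obtain ⟨f, hf, hfe⟩ := exists_continuousOn_eqOn_exp_comp (X := ℝ × ℝ) (U := univ)
    (Homeomorph.Set.univ (ℝ × ℝ)).toHomotopyEquiv.simplyConnectedSpace isOpen_univ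
    (g := fun q ↦ p q.1 - γ q.2) (by fun_prop) (by rintro ⟨q, -, hq⟩; exact hne _ _ hq)
  rw [continuousOn_univ] at hf
  have hexp : ∀ s t, exp (f (s, t)) = p s - γ t := fun s t ↦ hfe (mem_univ (s, t))
  have edge_left := sub_eq_log_sub_log_of_exp_eq (f := fun t ↦ f (0, t)) (by fun_prop)
    (by fun_prop) (hexp 0) (fun t ↦ one_add_I_mul_mem_slitPlane (hne 0 t)
      (.inr (by simpa [hp0] using hγim t))) 0 1
  have edge_right := sub_eq_log_sub_log_of_exp_eq (f := fun t ↦ f (1, t)) (by fun_prop)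
    (by fun_prop) (hexp 1) (fun t ↦ one_add_I_mul_mem_slitPlane (hne 1 t)
      (.inr (by simpa [hp1] using hγim t))) 1 0
  have edge_bottom := sub_eq_log_sub_log_of_exp_eq (f := fun s ↦ f (s, 0)) (by fun_prop)
    (by fun_prop) (hexp · 0) (fun s ↦ one_add_I_mul_mem_slitPlane (hne s 0)
      (.inl (by simpa [hγ0] using hpre s))) 1 0
  have edge_top := sub_eq_log_sub_log_of_exp_eq (f := fun s ↦ f (s, 1)) (by fun_prop)
    (by fun_prop) (hexp · 1) (fun s ↦ neg_I_mul_mem_slitPlane (hne s 1)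
      (by simpa [hγ1] using hpim s)) 1 0
  have hlog : log ((1 + I) * (b - x₀ : ℝ)) - log ((1 + I) * (a - x₀ : ℝ)) =
      log (I * (x₀ - b : ℝ)) - log (I * (x₀ - a : ℝ)) := by
    have hI : ∀ x : ℝ, I * ((x₀ - x : ℝ) : ℂ) = -I * (x - x₀) := fun x ↦ by push_cast; ring
    simp only [hp0, hp1, hγ1] at edge_left edge_right edge_bottom edge_top
    rw [hI, hI]
    push_cast
    linear_combination edge_top - edge_left - edge_right - edge_bottom
  have him := congrArg im hlog
  rw [sub_im, sub_im, log_mul_ofReal_im_sub_eq_pi (by simp) (sub_pos.2 hxb) (sub_neg.2 hax)] at him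
  have hpi := log_mul_ofReal_im_sub_eq_pi (c := I) (by simp) (sub_pos.2 hax) (sub_neg.2 hxb)
  linarith [Real.pi_pos]

theorem not_joinedIn_of_crossing {S : Set ℂ} {a b x₀ y₀ : ℝ} (hS : ∀ z ∈ S, 0 ≤ z.im)
    (hJ : JoinedIn S (y₀ * I) x₀) (hax : a < x₀) (hxb : x₀ < b) :
    ¬ JoinedIn {z : ℂ | 0 < z.re ∧ z ∉ S ∧ conj z ∉ S} a b := by
  intro hab
  set p := hab.somePath.extend with hp
  have hpS : ∀ s, 0 < (p s).re ∧ p s ∉ S ∧ conj (p s) ∉ S := fun s ↦ hab.somePath_mem _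
  have hγS : ∀ t, hJ.somePath.extend t ∈ S := fun t ↦ hJ.somePath_mem _
  have hp_cont : Continuous p := hab.somePath.continuous_extend
  -- Reflecting the path to the upper half-plane keeps it off `S`.
  obtain ⟨s, t, hst⟩ := exists_eq_of_crossing (y₀ := y₀)
    (p := fun s ↦ (p s).re + (|(p s).im| : ℝ) * I) (by fun_prop)
    hJ.somePath.continuous_extend hax hxb (by simp [hp]) (by simp [hp]) (by simp) (by simp)
    (fun s ↦ by simp) (fun s ↦ by simpa using (hpS s).1) (fun t ↦ hS _ (hγS t))
  have hmem := hst ▸ hγS t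
  rcases abs_choice (p s).im with h | h <;> rw [h] at hmem
  · exact (hpS s).2.1 (by rwa [re_add_im] at hmem)
  · refine (hpS s).2.2 ?_
    convert hmem using 1
    apply Complex.ext <;> simp

theorem joinedIn_norm_of_re_pos {v : ℂ} (hv : 0 < v.re) :
    JoinedIn {z : ℂ | 0 < z.re ∧ ‖z‖ = ‖v‖} v ‖v‖ := by
  have hpos : 0 < ‖v‖ := hv.trans_le (re_le_norm v)
  have harc : IsPathConnected
      ((fun θ : ℝ ↦ ‖v‖ * exp (θ * I)) '' Ioo (-(Real.pi / 2)) (Real.pi / 2)) :=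
    ((convex_Ioo _ _).isPathConnected ⟨0, by simp [Real.pi_pos]⟩).image (by fun_prop)
  refine (harc.joinedIn v ⟨arg v, ?_, norm_mul_exp_arg_mul_I v⟩ ‖v‖
    ⟨0, by simp [Real.pi_pos], by simp⟩).mono ?_
  · exact abs_lt.1 (abs_arg_lt_pi_div_two_iff.2 (.inl hv))
  · rintro _ ⟨θ, hθ, rfl⟩
    refine ⟨?_, by simp [norm_exp_ofReal_mul_I]⟩
    rw [re_ofReal_mul, exp_ofReal_mul_I_re]
    exact mul_pos hpos (Real.cos_pos_of_mem_Ioo hθ)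

theorem isBounded_connectedComponentIn_of_joinedIn {K : Set ℂ} {a x₀ y₀ : ℝ} (hK : IsClosed K)
    (hconj : ∀ z ∈ K, conj z ∈ K) (hJ : JoinedIn (K ∩ {z | 0 ≤ z.im}) (y₀ * I) x₀)
    (hax : a < x₀) : Bornology.IsBounded (connectedComponentIn ({z : ℂ | 0 < z.re} \ K) a) := by
  set U : Set ℂ := {z : ℂ | 0 < z.re} \ K
  set Γ : Set ℂ := range hJ.somePath
  have hΓ : ∀ z ∈ Γ, z ∈ K ∧ 0 ≤ z.im := by
    rintro _ ⟨t, rfl⟩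
    exact hJ.somePath_mem t
  have hJΓ : JoinedIn Γ (y₀ * I) x₀ := ⟨hJ.somePath, mem_range_self⟩
  obtain ⟨R, hR⟩ := (isCompact_range hJ.somePath.continuous).isBounded.exists_norm_le
  refine (isBounded_closedBall (x := (0 : ℂ)) (r := R)).subset fun v hv ↦ ?_
  rw [mem_closedBall_zero_iff]
  by_contra! hvR
  have hU : IsOpen U := (isOpen_lt continuous_const continuous_re).sdiff hK
  have haU : (a : ℂ) ∈ U := connectedComponentIn_nonempty_iff.1 ⟨v, hv⟩
  have hpath : JoinedIn U a v :=
    (hU.connectedComponentIn.isConnected_iff_isPathConnected.1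
      (isConnected_connectedComponentIn_iff.2 haU)).joinedIn _ (mem_connectedComponentIn haU) _ hv
    |>.mono (connectedComponentIn_subset _ _)
  have hx₀v : x₀ < ‖v‖ := calc
    x₀ ≤ ‖(x₀ : ℂ)‖ := by simpa using le_abs_self x₀
    _ ≤ R := hR _ hJΓ.target_mem
    _ < ‖v‖ := hvR
  refine not_joinedIn_of_crossing (fun z hz ↦ (hΓ z hz).2) hJΓ hax hx₀v
    (JoinedIn.trans (y := v) (hpath.mono ?_)
      ((joinedIn_norm_of_re_pos (connectedComponentIn_subset _ _ hv).1).mono ?_))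
  · exact fun z hz ↦ ⟨hz.1, fun h ↦ hz.2 (hΓ z h).1,
      fun h ↦ hz.2 (by simpa using hconj _ (hΓ _ h).1)⟩
  · rintro z ⟨hz, hzv⟩
    exact ⟨hz, fun h ↦ (hR z h).not_gt (hzv ▸ hvR),
      fun h ↦ (hR _ h).not_gt (by rwa [norm_conj, hzv])⟩

end Crossing

section MaximumPrinciple

variable {F : ℂ → ℂ} {U : Set ℂ} {M N : ℝ}

theorem re_nonneg_of_mem_closure (hU : ∀ z ∈ U, 0 ≤ z.re) : ∀ z ∈ closure U, 0 ≤ z.re :=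
  closure_minimal (t := {z : ℂ | 0 ≤ z.re}) hU (isClosed_le continuous_const continuous_re)

theorem norm_pow_le_mul_norm_add_one (hM : 0 < M) (hU : ∀ z ∈ U, 0 ≤ z.re)
    (hF : DiffContOnCl ℂ F U) (hN : ∀ z ∈ closure U, ‖F z‖ ≤ N)
    (hfr : ∀ z ∈ frontier U, ‖F z‖ ≤ M) {z : ℂ} (hz : z ∈ U) (n : ℕ) :
    ‖F z‖ ^ n ≤ M ^ n * ‖z + 1‖ := by
  have hone : ∀ w ∈ closure U, 1 ≤ ‖w + 1‖ := fun w hw ↦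
    le_trans (by simpa using re_nonneg_of_mem_closure hU w hw) (re_le_norm (w + 1))
  set R : ℝ := max ‖z‖ (N ^ n / M ^ n) + 1
  set V : Set ℂ := U ∩ ball 0 R
  have hVU : closure V ⊆ closure U := closure_mono inter_subset_left
  have hzV : z ∈ V := ⟨hz, by
    rw [mem_ball_zero_iff]
    exact (le_max_left _ _).trans_lt (lt_add_one _)⟩
  have hquot : DiffContOnCl ℂ (fun w ↦ F w ^ n / (w + 1)) V := by
    have hne : ∀ w ∈ closure V, w + 1 ≠ 0 := fun w hw ↦
      norm_pos_iff.1 (one_pos.trans_le (hone w (hVU hw)))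
    exact ⟨((hF.differentiableOn.mono inter_subset_left).pow n).div (by fun_prop)
      fun w hw ↦ hne w (subset_closure hw),
      ((hF.continuousOn.mono hVU).pow n).div (by fun_prop) hne⟩
  have hquot_le : ∀ w ∈ frontier V, ‖F w ^ n / (w + 1)‖ ≤ M ^ n := by
    intro w hw
    have hw1 := hone w (hVU hw.1)
    rw [norm_div, norm_pow, div_le_iff₀ (by linarith)]
    rcases frontier_inter_subset _ _ hw with h | h
    · calc ‖F w‖ ^ n ≤ M ^ n := by gcongr; exact hfr w h.1
        _ ≤ M ^ n * ‖w + 1‖ := le_mul_of_one_le_right (by positivity) hw1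
    · have hwR : ‖w‖ = R := by simpa using frontier_ball_subset_sphere h.2
      have hlarge : N ^ n / M ^ n ≤ ‖w + 1‖ := calc
        N ^ n / M ^ n ≤ R - 1 := by simp [R]
        _ ≤ ‖w + 1‖ := by simpa [hwR] using norm_sub_norm_le w (-1)
      calc ‖F w‖ ^ n ≤ N ^ n := by gcongr; exact hN w (hVU hw.1)
        _ ≤ M ^ n * ‖w + 1‖ := (div_le_iff₀' (by positivity)).1 hlarge
  have hmax := norm_le_of_forall_mem_frontier_norm_le
    (isBounded_ball.subset inter_subset_right) hquot hquot_le (subset_closure hzV)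
  rwa [norm_div, norm_pow, div_le_iff₀ (one_pos.trans_le (hone z (subset_closure hz)))] at hmax

theorem norm_le_of_forall_mem_frontier_of_re_nonneg (hM : 0 < M) (hU : ∀ z ∈ U, 0 ≤ z.re)
    (hF : DiffContOnCl ℂ F U) (hN : ∀ z ∈ closure U, ‖F z‖ ≤ N)
    (hfr : ∀ z ∈ frontier U, ‖F z‖ ≤ M) {z : ℂ} (hz : z ∈ U) : ‖F z‖ ≤ M := by
  by_contra! hlt
  obtain ⟨n, hn⟩ := pow_unbounded_of_one_lt ‖z + 1‖ ((one_lt_div hM).2 hlt)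
  rw [div_pow, lt_div_iff₀' (by positivity)] at hn
  exact hn.not_ge (norm_pow_le_mul_norm_add_one hM hU hF hN hfr hz n)

end MaximumPrinciple

section LocalMaximum

theorem even_and_neg_of_pow_mul_nonpos {ψ : ℝ → ℝ} {x₀ : ℝ} {m : ℕ} (hψ : ContinuousAt ψ x₀)
    (hψ₀ : ψ x₀ ≠ 0) (h : ∀ᶠ x in 𝓝 x₀, (x - x₀) ^ m * ψ x ≤ 0) : Even m ∧ ψ x₀ < 0 := by
  have hneg : ψ x₀ < 0 := by
    refine hψ₀.lt_of_le (not_lt.1 fun hpos ↦ ?_)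
    obtain ⟨x, ⟨hx, hψx⟩, hxx₀⟩ := ((h.and (hψ.eventually_const_lt hpos)).filter_mono
      nhdsWithin_le_nhds |>.and (self_mem_nhdsWithin (s := Ioi x₀))).exists
    exact hx.not_gt (mul_pos (pow_pos (sub_pos.2 hxx₀) m) hψx)
  refine ⟨Nat.not_odd_iff_even.1 fun hodd ↦ ?_, hneg⟩
  obtain ⟨x, ⟨hx, hψx⟩, hxx₀⟩ := ((h.and (hψ.eventually_lt_const hneg)).filter_mono
    nhdsWithin_le_nhds |>.and (self_mem_nhdsWithin (s := Iio x₀))).exists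
  exact hx.not_gt (mul_pos_of_neg_of_neg (hodd.pow_neg (sub_neg.2 hxx₀)) hψx)

variable {f : ℂ → ℂ} {x₀ : ℝ}

theorem exists_even_pow_smul_of_isLocalMax (hf : AnalyticAt ℂ f x₀)
    (him : ∀ᶠ x : ℝ in 𝓝 x₀, (f x).im = 0) (hmax : ∀ᶠ x : ℝ in 𝓝 x₀, (f x).re ≤ (f x₀).re)
    (hconst : ¬ ∀ᶠ z in 𝓝 (x₀ : ℂ), f z = f x₀) :
    ∃ (m : ℕ) (g : ℂ → ℂ), m ≠ 0 ∧ Even m ∧ ContinuousAt g x₀ ∧ (g x₀).re < 0 ∧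
      ∀ᶠ z in 𝓝 (x₀ : ℂ), f z = f x₀ + (z - x₀) ^ m * g z := by
  obtain ⟨m, g, hg, hg₀, hfg⟩ := (AnalyticAt.exists_eventuallyEq_pow_smul_nonzero_iff
    (f := fun z ↦ f z - f x₀) (by fun_prop)).2 (by simpa [sub_eq_zero] using hconst)
  replace hfg : ∀ᶠ z in 𝓝 (x₀ : ℂ), f z = f x₀ + (z - x₀) ^ m * g z := by
    filter_upwards [hfg] with z hz
    linear_combination hz
  have hfg_real : ∀ᶠ x : ℝ in 𝓝 x₀, f x = f x₀ + ((x - x₀) ^ m : ℝ) * g x := by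
    filter_upwards [continuous_ofReal.continuousAt.eventually hfg] with x hx
    simpa using hx
  have hg_real : ContinuousAt (fun x : ℝ ↦ g x) x₀ :=
    hg.continuousAt.comp continuous_ofReal.continuousAt
  have hg_im : (g x₀).im = 0 := by
    by_contra hne
    have himg : ∀ᶠ x : ℝ in 𝓝 x₀, (x - x₀) ^ m * (g x).im = 0 := by
      filter_upwards [hfg_real, him] with x hx hfx
      rwa [hx, add_im, him.self_of_nhds, zero_add, im_ofReal_mul] at hfx
    have hlt := (even_and_neg_of_pow_mul_nonpos (ψ := fun x ↦ (g x).im)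
      (continuous_im.continuousAt.comp hg_real) hne (himg.mono fun x hx ↦ hx.le)).2
    have hgt := (even_and_neg_of_pow_mul_nonpos (m := m) (ψ := fun x ↦ -(g x).im)
      (continuous_im.continuousAt.comp hg_real).neg (neg_ne_zero.2 hne)
      (himg.mono fun x hx ↦ by simp [hx])).2
    linarith
  obtain ⟨heven, hneg⟩ := even_and_neg_of_pow_mul_nonpos (m := m) (ψ := fun x ↦ (g x).re)
    (continuous_re.continuousAt.comp hg_real) (fun h ↦ hg₀ (Complex.ext h hg_im)) (by
      filter_upwards [hfg_real, hmax] with x hx hfx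
      rwa [hx, add_re, re_ofReal_mul, add_le_iff_nonpos_right] at hfx)
  refine ⟨m, g, ?_, heven, hg.continuousAt, hneg, hfg⟩
  rintro rfl
  exact hg₀ (by simpa using hfg.self_of_nhds)

theorem exists_ray_le_re_of_isLocalMax (hf : AnalyticAt ℂ f x₀)
    (him : ∀ᶠ x : ℝ in 𝓝 x₀, (f x).im = 0) (hmax : ∀ᶠ x : ℝ in 𝓝 x₀, (f x).re ≤ (f x₀).re)
    (hconst : ¬ ∀ᶠ z in 𝓝 (x₀ : ℂ), f z = f x₀) :
    ∃ (m : ℕ) (c : ℝ) (u : ℂ), 0 < c ∧ 0 < u.im ∧ ‖u‖ = 1 ∧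
      ∀ᶠ r : ℝ in 𝓝 0, (f x₀).re + c * r ^ m ≤ (f (x₀ + r * u)).re := by
  obtain ⟨m, g, hm, heven, hg, hneg, hfg⟩ := exists_even_pow_smul_of_isLocalMax hf him hmax hconst
  have hm2 : (1 : ℝ) < m := by exact_mod_cast (by grind : 1 < m)
  set u : ℂ := exp ((Real.pi / m : ℝ) * I)
  have hum : u ^ m = -1 := by
    rw [← exp_nat_mul, ← exp_pi_mul_I]
    congr 1
    push_cast
    field_simp
  have huim : 0 < u.im := by
    rw [exp_ofReal_mul_I_im]
    exact Real.sin_pos_of_pos_of_lt_pi (by positivity) (div_lt_self Real.pi_pos hm2)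
  have hray : Tendsto (fun r : ℝ ↦ (x₀ : ℂ) + r * u) (𝓝 0) (𝓝 x₀) :=
    Continuous.tendsto' (by fun_prop) _ _ (by simp)
  have hgre : ∀ᶠ z in 𝓝 (x₀ : ℂ), (g z).re < (g x₀).re / 2 :=
    (continuous_re.continuousAt.comp hg).eventually_lt_const
      (show (g x₀).re < (g x₀).re / 2 by linarith)
  refine ⟨m, -(g x₀).re / 2, u, by linarith, huim, norm_exp_ofReal_mul_I _, ?_⟩
  filter_upwards [hray.eventually (hfg.and hgre)] with r ⟨hfr, hgr⟩
  have hfr' : f (x₀ + r * u) = f x₀ - (r ^ m : ℝ) * g (x₀ + r * u) := by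
    rw [hfr, add_sub_cancel_left, mul_pow, hum]
    push_cast
    ring
  rw [hfr', sub_re, re_ofReal_mul]
  nlinarith [heven.pow_nonneg r]

end LocalMaximum

section RealPeak

/-- `F` is bounded, holomorphic and symmetric on the right half-plane, continuous up to the
imaginary axis and not constant near `x₀`, and `|F|` attains its maximum over `[0, ∞)`, normalised
to be `F x₀ = 1`, at the interior point `x₀`. -/
structure HasRealPeak (F : ℂ → ℂ) (x₀ : ℝ) : Prop where
  differentiableOn : DifferentiableOn ℂ F {z | 0 < z.re}
  continuousOn : ContinuousOn F {z | 0 ≤ z.re}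
  exists_norm_le : ∃ N : ℝ, ∀ z : ℂ, 0 ≤ z.re → ‖F z‖ ≤ N
  map_conj : ∀ z : ℂ, 0 ≤ z.re → F (conj z) = conj (F z)
  norm_le_one : ∀ x : ℝ, 0 ≤ x → ‖F x‖ ≤ 1
  pos : 0 < x₀
  apply_eq_one : F x₀ = 1
  not_eventually_eq_one : ¬ ∀ᶠ z in 𝓝 (x₀ : ℂ), F z = 1

/-- The part of the closed right half-plane where `‖F‖` exceeds `1` by at least a constant times
the `m`-th power of the distance to `x₀`. The constant is `C⁻¹`, and the point `x₀` itself is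
included when `‖F x₀‖ = 1` and `m ≠ 0`. -/
def peakRegion (F : ℂ → ℂ) (x₀ : ℝ) (m : ℕ) (C : ℝ) : Set ℂ :=
  {z | 0 ≤ z.re ∧ ‖z - x₀‖ ^ m ≤ C * (‖F z‖ - 1)}

theorem joinedIn_inter_of_mem_closure {E : Type*} [NormedAddCommGroup E] [NormedSpace ℝ E]
    {Q S Ω : Set E} {w p : E} (hQ : Convex ℝ Q) (hwQ : w ∈ Q) (hS : S ∈ 𝓝[Q] w)
    (hΩ : IsPathConnected Ω) (hΩS : Ω ⊆ Q ∩ S) (hw : w ∈ closure Ω) (hp : p ∈ Ω) :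
    JoinedIn (Q ∩ S) w p := by
  obtain ⟨δ, hδ, hball⟩ := mem_nhdsWithin_iff.1 hS
  obtain ⟨q, hqw, hqΩ⟩ := mem_closure_iff_nhds.1 hw _ (ball_mem_nhds w hδ)
  have hwq : JoinedIn (Q ∩ S) w q := JoinedIn.of_segment_subset fun z hz ↦
    have hzQ := hQ.segment_subset hwQ (hΩS hqΩ).1 hz
    ⟨hzQ, hball ⟨(convex_ball w δ).segment_subset (mem_ball_self hδ) hqw hz, hzQ⟩⟩
  exact hwq.trans ((hΩ.joinedIn q hqΩ p hp).mono hΩS)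

variable {F : ℂ → ℂ} {x₀ C : ℝ} {m : ℕ}

theorem peakRegion_mono (hC : 0 < C) {C' : ℝ} (hCC' : C ≤ C') :
    peakRegion F x₀ m C ⊆ peakRegion F x₀ m C' := fun z ⟨hz, hle⟩ ↦
  ⟨hz, hle.trans (mul_le_mul_of_nonneg_right hCC'
    (nonneg_of_mul_nonneg_right ((by positivity : 0 ≤ ‖z - x₀‖ ^ m).trans hle) hC))⟩

namespace HasRealPeak

theorem im_apply_ofReal (hF : HasRealPeak F x₀) {x : ℝ} (hx : 0 ≤ x) : (F x).im = 0 :=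
  conj_eq_iff_im.1 (by rw [← hF.map_conj x hx, conj_ofReal])

theorem exists_ray (hF : HasRealPeak F x₀) :
    ∃ (m : ℕ) (c : ℝ) (u : ℂ), 0 < c ∧ 0 < u.im ∧ ‖u‖ = 1 ∧
      ∀ᶠ r : ℝ in 𝓝 0, 1 + c * r ^ m ≤ ‖F (x₀ + r * u)‖ := by
  have hana : AnalyticAt ℂ F x₀ := hF.differentiableOn.analyticAt
    ((isOpen_lt continuous_const continuous_re).mem_nhds (by simpa using hF.pos))
  have him : ∀ᶠ x : ℝ in 𝓝 x₀, (F x).im = 0 := by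
    filter_upwards [lt_mem_nhds hF.pos] with x hx using hF.im_apply_ofReal hx.le
  have hmax : ∀ᶠ x : ℝ in 𝓝 x₀, (F x).re ≤ (F x₀).re := by
    filter_upwards [lt_mem_nhds hF.pos] with x hx
    simpa [hF.apply_eq_one] using (re_le_norm _).trans (hF.norm_le_one x hx.le)
  obtain ⟨m, c, u, hc, hu, hu1, hray⟩ := exists_ray_le_re_of_isLocalMax hana him hmax
    (by simpa [hF.apply_eq_one] using hF.not_eventually_eq_one)
  refine ⟨m, c, u, hc, hu, hu1, hray.mono fun r hr ↦ ?_⟩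
  rw [hF.apply_eq_one, one_re] at hr
  exact hr.trans (re_le_norm _)

theorem isClosed_peakRegion (hF : HasRealPeak F x₀) : IsClosed (peakRegion F x₀ m C) := by
  have hclosed : IsClosed {z : ℂ | 0 ≤ z.re} := isClosed_le continuous_const continuous_re
  have hcont : ContinuousOn F {z : ℂ | 0 ≤ z.re} := hF.continuousOn
  have hcont' : ContinuousOn (fun z ↦ C * (‖F z‖ - 1) - ‖z - x₀‖ ^ m) {z : ℂ | 0 ≤ z.re} := by
    fun_prop
  convert hcont'.preimage_isClosed_of_isClosed hclosed isClosed_Ici (t := Ici 0) using 1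
  ext z
  simp [peakRegion]

theorem conj_mem_peakRegion (hF : HasRealPeak F x₀) {z : ℂ} (hz : z ∈ peakRegion F x₀ m C) :
    conj z ∈ peakRegion F x₀ m C := by
  obtain ⟨hre, hle⟩ := hz
  refine ⟨by simpa using hre, ?_⟩
  rwa [hF.map_conj z hre, norm_conj, ← norm_conj, map_sub, conj_conj, conj_ofReal]

theorem ofReal_notMem_peakRegion (hF : HasRealPeak F x₀) (hC : 0 < C) {x : ℝ} (hx : 0 ≤ x)
    (hne : x ≠ x₀) : (x : ℂ) ∉ peakRegion F x₀ m C := by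
  rintro ⟨-, hle⟩
  have hpos : 0 < ‖(x : ℂ) - x₀‖ ^ m :=
    pow_pos (norm_pos_iff.2 (sub_ne_zero.2 (ofReal_injective.ne hne))) m
  nlinarith [hF.norm_le_one x hx]

theorem isOpen_quadrant_inter_one_lt_norm (hF : HasRealPeak F x₀) :
    IsOpen (Ioi 0 ×ℂ Ioi 0 ∩ {z | 1 < ‖F z‖}) :=
  (hF.continuousOn.mono fun z (hz : z ∈ Ioi 0 ×ℂ Ioi 0) ↦
    (le_of_lt hz.1 : 0 ≤ z.re)).norm.isOpen_inter_preimage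
    (isOpen_Ioi.reProdIm isOpen_Ioi) isOpen_Ioi

theorem exists_mem_closure_mul_I (hF : HasRealPeak F x₀) {p : ℂ} {Ω : Set ℂ}
    (hΩ : Ω = connectedComponentIn (Ioi 0 ×ℂ Ioi 0 ∩ {z | 1 < ‖F z‖}) p) (hp : p ∈ Ω) :
    ∃ y : ℝ, 0 ≤ y ∧ y * I ∈ closure Ω ∧ 1 < ‖F (y * I)‖ := by
  set Q : Set ℂ := Ioi 0 ×ℂ Ioi 0 ∩ {z | 1 < ‖F z‖}
  have hQ : IsOpen Q := hF.isOpen_quadrant_inter_one_lt_norm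
  have hΩQ : Ω ⊆ Q := hΩ ▸ connectedComponentIn_subset Q p
  have hcl : closure Ω ⊆ Ici 0 ×ℂ Ici 0 := calc
    closure Ω ⊆ closure (Ioi 0 ×ℂ Ioi 0) := closure_mono fun z hz ↦ (hΩQ hz).1
    _ = Ici 0 ×ℂ Ici 0 := by rw [closure_reProdIm, closure_Ioi]
  obtain ⟨N, hN⟩ := hF.exists_norm_le
  obtain ⟨w, hw, hw1⟩ : ∃ w ∈ frontier Ω, 1 < ‖F w‖ := by
    by_contra! hfr
    refine (hΩQ hp).2.not_ge (norm_le_of_forall_mem_frontier_of_re_nonneg one_pos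
      (fun z hz ↦ (hΩQ hz).1.1.le) ?_ (fun z hz ↦ hN z (hcl hz).1) hfr hp)
    exact ⟨hF.differentiableOn.mono fun z hz ↦ (hΩQ hz).1.1,
      hF.continuousOn.mono fun z hz ↦ (hcl hz).1⟩
  obtain ⟨hre, him⟩ := hcl hw.1
  have him' : 0 < w.im := by
    refine lt_of_le_of_ne him fun h ↦ hw1.not_ge ?_
    rw [(Complex.ext rfl h.symm : w = (w.re : ℂ))]
    exact hF.norm_le_one _ hre
  have hre' : w.re = 0 := by
    by_contra h
    exact notMem_of_mem_frontier_connectedComponentIn hQ (hΩ ▸ hw)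
      ⟨⟨lt_of_le_of_ne hre (Ne.symm h), him'⟩, hw1⟩
  have hwI : w.im * I = w := Complex.ext (by simp [hre']) (by simp)
  exact ⟨w.im, him, hwI.symm ▸ hw.1, hwI.symm ▸ hw1⟩

theorem exists_joinedIn_mul_I (hF : HasRealPeak F x₀) {p : ℂ} (hpre : 0 < p.re) (hpim : 0 < p.im)
    (hp : 1 < ‖F p‖) :
    ∃ y : ℝ, JoinedIn (Ici 0 ×ℂ Ici 0 ∩ {z | 1 < ‖F z‖}) (y * I) p := by
  set Q : Set ℂ := Ioi 0 ×ℂ Ioi 0 ∩ {z | 1 < ‖F z‖}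
  have hpQ : p ∈ Q := ⟨⟨hpre, hpim⟩, hp⟩
  have hQ : IsOpen Q := hF.isOpen_quadrant_inter_one_lt_norm
  obtain ⟨y, hy, hycl, hy1⟩ := hF.exists_mem_closure_mul_I rfl (mem_connectedComponentIn hpQ)
  have hyQ : (y : ℂ) * I ∈ Ici (0 : ℝ) ×ℂ Ici 0 := by simpa [mem_reProdIm] using hy
  refine ⟨y, joinedIn_inter_of_mem_closure
    ((convex_halfSpace_re_ge 0).inter (convex_halfSpace_im_ge 0)) hyQ ?_
    (hQ.connectedComponentIn.isConnected_iff_isPathConnected.1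
      (isConnected_connectedComponentIn_iff.2 hpQ)) ?_ hycl (mem_connectedComponentIn hpQ)⟩
  · exact nhdsWithin_mono _ (fun z hz ↦ hz.1)
      ((hF.continuousOn _ hyQ.1).norm.eventually_const_lt hy1)
  · exact (connectedComponentIn_subset _ _).trans (inter_subset_inter_left _ (inter_subset_inter
      (preimage_mono Ioi_subset_Ici_self) (preimage_mono Ioi_subset_Ici_self)))

theorem exists_joinedIn_peakRegion_of_one_lt (hF : HasRealPeak F x₀) (m : ℕ) {w p : ℂ}
    (hwp : JoinedIn (Ici 0 ×ℂ Ici 0 ∩ {z | 1 < ‖F z‖}) w p) :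
    ∃ C > 0, JoinedIn (peakRegion F x₀ m C ∩ {z | 0 ≤ z.im}) w p := by
  set Γ : Set ℂ := range hwp.somePath
  have hΓ : ∀ z ∈ Γ, z ∈ Ici 0 ×ℂ Ici 0 ∩ {z | 1 < ‖F z‖} := by
    rintro _ ⟨t, rfl⟩
    exact hwp.somePath_mem t
  have hcont : ContinuousOn F Γ := hF.continuousOn.mono fun z hz ↦ (hΓ z hz).1.1
  obtain ⟨C, hC⟩ := (isCompact_range hwp.somePath.continuous).exists_bound_of_continuousOn
    (f := fun z ↦ ‖z - x₀‖ ^ m / (‖F z‖ - 1))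
    (ContinuousOn.div (by fun_prop) (by fun_prop) fun z hz ↦ (sub_pos.2 (hΓ z hz).2).ne')
  refine ⟨max C 1, by positivity, JoinedIn.mono ⟨hwp.somePath, mem_range_self⟩ fun z hz ↦ ?_⟩
  obtain ⟨⟨hre, him⟩, h1⟩ := hΓ z hz
  exact ⟨⟨hre, (div_le_iff₀ (sub_pos.2 h1)).1
    ((le_abs_self _).trans ((hC z hz).trans (le_max_left _ _)))⟩, him⟩

theorem exists_joinedIn_peakRegion (hF : HasRealPeak F x₀) :
    ∃ (m : ℕ) (C y : ℝ), 0 < C ∧ JoinedIn (peakRegion F x₀ m C ∩ {z | 0 ≤ z.im}) (y * I) x₀ := by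
  obtain ⟨m, c, u, hc, hu, hu1, hray⟩ := hF.exists_ray
  have hre : ∀ᶠ r : ℝ in 𝓝 0, 0 < ((x₀ : ℂ) + r * u).re :=
    ContinuousAt.eventually_lt (by fun_prop) (by fun_prop) (by simpa using hF.pos)
  obtain ⟨δ, hδ, hball⟩ := Metric.eventually_nhds_iff_ball.1 (hray.and hre)
  obtain ⟨ρ, hρ, hρδ⟩ := exists_between hδ
  have hseg : ∀ r ∈ Icc 0 ρ, 1 + c * r ^ m ≤ ‖F (x₀ + r * u)‖ ∧ 0 < ((x₀ : ℂ) + r * u).re :=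
    fun r hr ↦ hball r (by simpa [Real.norm_of_nonneg hr.1] using hr.2.trans_lt hρδ)
  obtain ⟨hρF, hρre⟩ := hseg ρ (right_mem_Icc.2 hρ.le)
  obtain ⟨y, hy⟩ := hF.exists_joinedIn_mul_I (p := x₀ + ρ * u) hρre
    (by simpa using mul_pos hρ hu)
    (lt_of_lt_of_le (lt_add_of_pos_right _ (by positivity)) hρF)
  obtain ⟨C, hC, hyC⟩ := hF.exists_joinedIn_peakRegion_of_one_lt m hy
  have hx₀ : JoinedIn (peakRegion F x₀ m c⁻¹ ∩ {z | 0 ≤ z.im}) (x₀ + ρ * u) x₀ := by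
    refine (JoinedIn.of_segment_subset (x := (x₀ : ℂ)) fun z hz ↦ ?_).symm
    rw [segment_eq_image'] at hz
    obtain ⟨t, ⟨ht0, ht1⟩, htz⟩ := hz
    replace htz : x₀ + (t * ρ : ℝ) * u = z := by
      simp only [← htz, add_sub_cancel_left, real_smul, ofReal_mul, mul_assoc]
    have hr : t * ρ ∈ Icc 0 ρ := ⟨by positivity, mul_le_of_le_one_left hρ.le ht1⟩
    obtain ⟨hrF, hrre⟩ := hseg _ hr
    rw [← htz]
    refine ⟨⟨hrre.le, ?_⟩, ?_⟩
    · rw [add_sub_cancel_left, norm_mul, hu1, mul_one, norm_real, Real.norm_of_nonneg hr.1,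
        le_inv_mul_iff₀ hc]
      linarith
    · simpa using mul_nonneg hr.1 hu.le
  exact ⟨m, max C c⁻¹, y, by positivity, (hyC.mono (inter_subset_inter_left _
    (peakRegion_mono hC (le_max_left _ _)))).trans (hx₀.mono (inter_subset_inter_left _
    (peakRegion_mono (inv_pos.2 hc) (le_max_right _ _))))⟩

theorem exists_isBounded_domain (hF : HasRealPeak F x₀) :
    ∃ (V : Set ℂ) (m : ℕ) (C r : ℝ), 0 < C ∧ 0 < r ∧ Bornology.IsBounded V ∧
      {z | 0 < z.re} ∩ ball 0 r ⊆ V ∧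
      ∀ w ∈ frontier V, w.re = 0 ∨ w ∈ peakRegion F x₀ m C := by
  obtain ⟨m, C, y, hC, hJ⟩ := hF.exists_joinedIn_peakRegion
  have hK : IsClosed (peakRegion F x₀ m C) := hF.isClosed_peakRegion
  obtain ⟨r, hr, hball⟩ := Metric.isOpen_iff.1 hK.isOpen_compl 0
    (by simpa using hF.ofReal_notMem_peakRegion hC le_rfl hF.pos.ne)
  obtain ⟨a, ha0, har⟩ := exists_between (lt_min hr hF.pos)
  set U : Set ℂ := {z : ℂ | 0 < z.re} \ peakRegion F x₀ m C
  have hU : IsOpen U := (isOpen_lt continuous_const continuous_re).sdiff hK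
  have hVU := connectedComponentIn_subset U a
  refine ⟨connectedComponentIn U a, m, C, r, hC, hr, ?_, ?_, ?_⟩
  · exact isBounded_connectedComponentIn_of_joinedIn hK (fun _ ↦ hF.conj_mem_peakRegion) hJ
      (har.trans_le (min_le_right _ _))
  · refine ((convex_halfSpace_re_gt 0).inter (convex_ball 0 r)).isPreconnected
      |>.subset_connectedComponentIn ⟨by simpa using ha0, ?_⟩ fun z hz ↦ ⟨hz.1, hball hz.2⟩
    simpa [abs_of_pos ha0] using har.trans_le (min_le_left _ _)
  · intro w hw
    have hwU := notMem_of_mem_frontier_connectedComponentIn hU hw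
    rcases (re_nonneg_of_mem_closure (fun z hz ↦ (hVU hz).1.le) w hw.1).eq_or_lt with h | h
    · exact .inl h.symm
    · exact .inr (not_not.1 fun hwK ↦ hwU ⟨h, hwK⟩)

theorem exists_halfDisc_norm_le (hF : HasRealPeak F x₀) (E : Type*) [NormedAddCommGroup E]
    [NormedSpace ℂ E] :
    ∃ r C : ℝ, 0 < r ∧ ∀ (h : ℂ → E) (B : ℝ), Differentiable ℂ h →
      (∀ z : ℂ, z.re = 0 → ‖h z‖ ≤ B) →
      (∀ z : ℂ, 0 ≤ z.re → 1 < ‖F z‖ → ‖h z‖ * (‖F z‖ - 1) ≤ B) →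
      ∀ z : ℂ, 0 < z.re → ‖z‖ < r → ‖h z‖ ≤ C * B := by
  obtain ⟨V, m, C, r, hC, hr, hVb, hrV, hfr⟩ := hF.exists_isBounded_domain
  obtain ⟨R, hR⟩ := hVb.closure.exists_norm_le
  have hx₀ := hF.pos
  set C' : ℝ := max ((R + x₀) ^ m) C
  refine ⟨min r (x₀ / 2), C' / (x₀ / 2) ^ m, by positivity, fun h B hh hI hreg z hz hzr ↦ ?_⟩
  have hB : 0 ≤ B := (norm_nonneg _).trans (hI 0 zero_re)
  have hbound : ∀ w ∈ frontier V, ‖(w - x₀) ^ m • h w‖ ≤ C' * B := by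
    intro w hw
    rw [norm_smul, norm_pow]
    rcases hfr w hw with hw0 | ⟨hwre, hwC⟩
    · have hwR : ‖w - x₀‖ ≤ R + x₀ := (norm_sub_le _ _).trans
        (by simpa [abs_of_pos hx₀] using hR w hw.1)
      have hnonneg : 0 ≤ R + x₀ := (norm_nonneg _).trans hwR
      calc ‖w - x₀‖ ^ m * ‖h w‖ ≤ (R + x₀) ^ m * B := by gcongr; exact hI w hw0
        _ ≤ C' * B := by gcongr; exact le_max_left _ _
    · have hwB : (‖F w‖ - 1) * ‖h w‖ ≤ B := by
        rcases le_or_gt ‖F w‖ 1 with h1 | h1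
        · exact (mul_nonpos_of_nonpos_of_nonneg (sub_nonpos.2 h1) (norm_nonneg _)).trans hB
        · rw [mul_comm]; exact hreg w hwre h1
      calc ‖w - x₀‖ ^ m * ‖h w‖ ≤ C * (‖F w‖ - 1) * ‖h w‖ := by gcongr
        _ ≤ C * B := by rw [mul_assoc]; gcongr
        _ ≤ C' * B := by gcongr; exact le_max_right _ _
  have hmax := norm_le_of_forall_mem_frontier_norm_le hVb (f := fun w : ℂ ↦ (w - x₀) ^ m • h w)
    (Differentiable.diffContOnCl (by fun_prop)) hbound
    (subset_closure (hrV ⟨hz, by simpa using hzr.trans_le (min_le_left _ _)⟩))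
  have hdist : x₀ / 2 ≤ ‖z - x₀‖ := by
    have htri := norm_sub_norm_le (x₀ : ℂ) z
    rw [norm_real, Real.norm_of_nonneg hx₀.le, norm_sub_rev] at htri
    linarith [min_le_right r (x₀ / 2)]
  rw [div_mul_eq_mul_div, le_div_iff₀' (by positivity)]
  calc (x₀ / 2) ^ m * ‖h z‖ ≤ ‖z - x₀‖ ^ m * ‖h z‖ := by gcongr
    _ ≤ C' * B := by rwa [norm_smul, norm_pow] at hmax

theorem exists_forall_norm_le_of_frequently (hF : HasRealPeak F x₀) {E : Type*}
    [NormedAddCommGroup E] [NormedSpace ℂ E] {h : ℂ → E} (hh : Differentiable ℂ h) {B : ℝ}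
    (haxis : ∀ z : ℂ, z.re = 0 → ‖h z‖ ≤ B)
    (hfreq : ∃ᶠ s : ℝ in 𝓝[>] 0, ∀ z : ℂ, 0 ≤ z.re → ‖h z‖ * (‖F (s * z)‖ - 1) ≤ B) :
    ∃ C : ℝ, ∀ z : ℂ, 0 < z.re → ‖h z‖ ≤ C := by
  obtain ⟨r, C, hr, hbound⟩ := hF.exists_halfDisc_norm_le E
  refine ⟨C * B, fun w hw ↦ ?_⟩
  have hsmall : ∀ᶠ s : ℝ in 𝓝[>] 0, s * ‖w‖ < r :=
    nhdsWithin_le_nhds (((continuous_mul_const ‖w‖).tendsto' 0 0 (zero_mul _)).eventually_lt_const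
      hr)
  obtain ⟨s, hmul, hsw, hs : 0 < s⟩ :=
    (hfreq.and_eventually (hsmall.and self_mem_nhdsWithin)).exists
  have hs₀ : (s : ℂ) ≠ 0 := ofReal_ne_zero.2 hs.ne'
  have hscaled := hbound (fun z ↦ h (z / s)) B (hh.comp (differentiable_id.div_const _))
    (fun z hz ↦ haxis _ (by rw [div_ofReal_re, hz, zero_div]))
    (fun z hz _ ↦ by
      simpa only [mul_div_cancel₀ z hs₀] using hmul (z / s) (by rw [div_ofReal_re]; positivity))
    (s * w) (by rw [re_ofReal_mul]; positivity)
    (by rwa [norm_mul, norm_real, Real.norm_of_nonneg hs.le])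
  simpa only [mul_div_cancel_left₀ w hs₀] using hscaled

end HasRealPeak

end RealPeak

section SignedMeasure

variable {Ω : Type*} [MeasurableSpace Ω] {E : Type*} [NormedAddCommGroup E]

instance isFiniteMeasure_variation (μ : SignedMeasure Ω) : IsFiniteMeasure μ.variation := by
  rw [← μ.totalVariation_eq_variation]
  infer_instance

variable {μ : SignedMeasure Ω} {f : Ω → E}

theorem integrable_posPart_and_negPart (hf : μ.Integrable f) :
    Integrable f μ.toJordanDecomposition.posPart ∧
      Integrable f μ.toJordanDecomposition.negPart := by
  rw [VectorMeasure.Integrable, ← μ.totalVariation_eq_variation] at hf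
  exact ⟨hf.left_of_add_measure, hf.right_of_add_measure⟩

variable [NormedSpace ℝ E]

theorem integral_signedMeasure_eq_sub (hf : μ.Integrable f) :
    ∫ᵛ ω, f ω ∂<•μ = ∫ ω, f ω ∂μ.toJordanDecomposition.posPart -
      ∫ ω, f ω ∂μ.toJordanDecomposition.negPart := by
  obtain ⟨hpos, hneg⟩ := integrable_posPart_and_negPart hf
  conv_lhs => rw [← μ.toSignedMeasure_toJordanDecomposition, JordanDecomposition.toSignedMeasure]
  rw [VectorMeasure.integral_sub_vectorMeasure, VectorMeasure.integral_toSignedMeasure,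
    VectorMeasure.integral_toSignedMeasure]
  · rwa [VectorMeasure.Integrable, Measure.variation_toSignedMeasure]
  · rwa [VectorMeasure.Integrable, Measure.variation_toSignedMeasure]

theorem map_integral_signedMeasure [CompleteSpace E] {G : Type*} [NormedAddCommGroup G]
    [NormedSpace ℝ G] [CompleteSpace G] (L : E →L[ℝ] G) (hf : μ.Integrable f) :
    L (∫ᵛ ω, f ω ∂<•μ) = ∫ᵛ ω, L (f ω) ∂<•μ := by
  obtain ⟨hpos, hneg⟩ := integrable_posPart_and_negPart hf
  rw [integral_signedMeasure_eq_sub hf, integral_signedMeasure_eq_sub (L.integrable_comp hf),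
    map_sub, L.integral_comp_comm hpos, L.integral_comp_comm hneg]

theorem norm_integral_signedMeasure_le {C : ℝ} (hf : ∀ ω, ‖f ω‖ ≤ C) :
    ‖∫ᵛ ω, f ω ∂<•μ‖ ≤ C * μ.variation.real univ := by
  have hflip : ‖(ContinuousLinearMap.lsmul ℝ ℝ : ℝ →L[ℝ] E →L[ℝ] E).flip‖ ≤ 1 :=
    (ContinuousLinearMap.opNorm_flip _).trans_le ContinuousLinearMap.opNorm_lsmul_le
  calc ‖∫ᵛ ω, f ω ∂<•μ‖
      ≤ ‖(ContinuousLinearMap.lsmul ℝ ℝ : ℝ →L[ℝ] E →L[ℝ] E).flip‖ * ∫ ω, ‖f ω‖ ∂μ.variation :=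
        VectorMeasure.norm_integral_le_integral_norm
    _ ≤ ∫ ω, ‖f ω‖ ∂μ.variation :=
        mul_le_of_le_one_left (integral_nonneg fun _ ↦ norm_nonneg _) hflip
    _ ≤ ∫ _, C ∂μ.variation :=
        integral_mono_of_nonneg (.of_forall fun _ ↦ norm_nonneg _) (integrable_const C)
          (.of_forall hf)
    _ = C * μ.variation.real univ := by rw [integral_const, smul_eq_mul, mul_comm]

end SignedMeasure

section LaplaceTransform

theorem norm_exp_neg_mul_le_one {z : ℂ} (hz : 0 ≤ z.re) (ξ : Ioi (0 : ℝ)) :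
    ‖exp (-(z * (ξ : ℝ)))‖ ≤ 1 := by
  rw [norm_exp, Real.exp_le_one_iff, neg_re, re_mul_ofReal, neg_nonpos]
  exact mul_nonneg hz (le_of_lt ξ.2)

theorem integrable_exp_neg_mul (ρ : Measure (Ioi (0 : ℝ))) [IsFiniteMeasure ρ] {z : ℂ}
    (hz : 0 ≤ z.re) : Integrable (fun ξ : Ioi (0 : ℝ) ↦ exp (-(z * (ξ : ℝ)))) ρ :=
  Integrable.of_bound (by fun_prop) 1 (.of_forall (norm_exp_neg_mul_le_one hz))

theorem differentiableOn_integral_exp_neg_mul (ρ : Measure (Ioi (0 : ℝ))) [IsFiniteMeasure ρ] :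
    DifferentiableOn ℂ (fun z : ℂ ↦ ∫ ξ : Ioi (0 : ℝ), exp (-(z * (ξ : ℝ))) ∂ρ)
      {z | 0 < z.re} := by
  have hexp : Ici (0 : ℝ) ⊆
      ProbabilityTheory.integrableExpSet (fun ξ : Ioi (0 : ℝ) ↦ -(ξ : ℝ)) ρ := by
    intro t ht
    refine Integrable.of_bound (by fun_prop) 1 (.of_forall fun ξ ↦ ?_)
    have hξ : (0 : ℝ) < ξ := ξ.2
    rw [Real.norm_eq_abs, Real.abs_exp, Real.exp_le_one_iff, mul_neg, neg_nonpos]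
    exact mul_nonneg ht hξ.le
  have hmgf := ProbabilityTheory.differentiableOn_complexMGF
    (X := fun ξ : Ioi (0 : ℝ) ↦ -(ξ : ℝ)) (μ := ρ)
  refine (hmgf.mono fun z hz ↦ ?_).congr fun z _ ↦ ?_
  · exact interior_mono hexp (by rwa [interior_Ici])
  · simp [ProbabilityTheory.complexMGF]

variable (μ : SignedMeasure (Ioi (0 : ℝ)))

theorem laplaceTransform_eq_sub {z : ℂ} (hz : 0 ≤ z.re) :
    laplaceTransform μ z =
      ∫ ξ : Ioi (0 : ℝ), exp (-(z * (ξ : ℝ))) ∂μ.toJordanDecomposition.posPart -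
      ∫ ξ : Ioi (0 : ℝ), exp (-(z * (ξ : ℝ))) ∂μ.toJordanDecomposition.negPart :=
  integral_signedMeasure_eq_sub (integrable_exp_neg_mul _ hz)

theorem differentiableOn_laplaceTransform :
    DifferentiableOn ℂ (laplaceTransform μ) {z | 0 < z.re} :=
  ((differentiableOn_integral_exp_neg_mul _).sub (differentiableOn_integral_exp_neg_mul _)).congr
    fun _ hz ↦ laplaceTransform_eq_sub μ (le_of_lt hz)

theorem continuousOn_laplaceTransform : ContinuousOn (laplaceTransform μ) {z | 0 ≤ z.re} :=
  VectorMeasure.continuousOn_of_dominated (fun _ _ ↦ by fun_prop)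
    (fun _ hz ↦ .of_forall (norm_exp_neg_mul_le_one hz)) (integrable_const 1)
    (.of_forall fun _ ↦ by fun_prop)

theorem norm_laplaceTransform_le {z : ℂ} (hz : 0 ≤ z.re) :
    ‖laplaceTransform μ z‖ ≤ μ.variation.real univ :=
  (norm_integral_signedMeasure_le (norm_exp_neg_mul_le_one hz)).trans_eq (one_mul _)

theorem laplaceTransform_conj {z : ℂ} (hz : 0 ≤ z.re) :
    laplaceTransform μ (conj z) = conj (laplaceTransform μ z) := calc
  laplaceTransform μ (conj z)
      = ∫ᵛ ξ : Ioi (0 : ℝ), conjCLE (exp (-(z * (ξ : ℝ)))) ∂<•μ := by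
        simp [laplaceTransform, ← exp_conj]
  _ = conj (laplaceTransform μ z) :=
        (map_integral_signedMeasure (conjCLE : ℂ →L[ℝ] ℂ) (integrable_exp_neg_mul _ hz)).symm

theorem laplaceTransform_zero : laplaceTransform μ 0 = μ univ := by
  simp [laplaceTransform]

theorem tendsto_laplaceTransform_atTop :
    Tendsto (fun x : ℝ ↦ laplaceTransform μ x) atTop (𝓝 0) := by
  have hlim : Tendsto (fun x : ℝ ↦ laplaceTransform μ x) atTop
      (𝓝 (∫ᵛ _ : Ioi (0 : ℝ), (0 : ℂ) ∂<•μ)) := by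
    refine VectorMeasure.tendsto_integral_filter_of_norm_le_const (.of_forall fun x ↦ by fun_prop)
      ⟨1, ?_⟩ (.of_forall fun ξ ↦ ?_)
    · filter_upwards [eventually_ge_atTop 0] with x hx
      exact .of_forall (norm_exp_neg_mul_le_one (by simpa using hx))
    · refine squeeze_zero_norm (fun x ↦ le_of_eq ?_)
        (Real.tendsto_exp_neg_atTop_nhds_zero.comp (tendsto_id.atTop_mul_const ξ.2))
      simp [norm_exp]
  rwa [VectorMeasure.integral_zero] at hlim

variable {μ}

theorem eq_zero_of_laplaceTransform_mul_I_eq_zero (h : ∀ y : ℝ, laplaceTransform μ (y * I) = 0) :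
    μ = 0 := by
  have hval : MeasurableEmbedding (Subtype.val : Ioi (0 : ℝ) → ℝ) :=
    MeasurableEmbedding.subtype_coe measurableSet_Ioi
  have hchar (ρ : Measure (Ioi (0 : ℝ))) (t : ℝ) : charFun (ρ.map Subtype.val) t =
      ∫ ξ : Ioi (0 : ℝ), exp (-((-t : ℝ) * I * (ξ : ℝ))) ∂ρ := by
    rw [charFun_apply_real, hval.integral_map]
    congr! 3
    push_cast
    ring
  have hmap : μ.toJordanDecomposition.posPart.map (Subtype.val : Ioi (0 : ℝ) → ℝ) =
      μ.toJordanDecomposition.negPart.map Subtype.val := by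
    refine Measure.ext_of_charFun (funext fun t ↦ ?_)
    rw [hchar, hchar, ← sub_eq_zero, ← laplaceTransform_eq_sub μ (by simp)]
    exact h (-t)
  have heq : μ.toJordanDecomposition.posPart = μ.toJordanDecomposition.negPart := by
    rw [← hval.comap_map μ.toJordanDecomposition.posPart, hmap, hval.comap_map]
  rw [← μ.toSignedMeasure_toJordanDecomposition, JordanDecomposition.toSignedMeasure]
  simp only [heq, sub_self]

theorem eq_zero_of_laplaceTransform_eventuallyEq_const {z₀ c : ℂ} (hz₀ : 0 < z₀.re)
    (h : ∀ᶠ z in 𝓝 z₀, laplaceTransform μ z = c) : μ = 0 := by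
  have heq : EqOn (laplaceTransform μ) (fun _ ↦ c) {z | 0 < z.re} :=
    ((differentiableOn_laplaceTransform μ).analyticOnNhd
      (isOpen_lt continuous_const continuous_re)).eqOn_of_preconnected_of_eventuallyEq
      analyticOnNhd_const (convex_halfSpace_re_gt 0).isPreconnected hz₀ h
  have hc : c = 0 := by
    refine tendsto_nhds_unique (tendsto_const_nhds.congr' ?_) (tendsto_laplaceTransform_atTop μ)
    filter_upwards [eventually_gt_atTop 0] with x hx
    exact (heq (by simpa using hx)).symm
  have hcl : EqOn (laplaceTransform μ) (fun _ ↦ c) {z | 0 ≤ z.re} :=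
    heq.of_subset_closure (continuousOn_laplaceTransform μ) continuousOn_const
      (fun _ ↦ le_of_lt (α := ℝ)) (closure_setOfPred_lt_re 0).ge
  exact eq_zero_of_laplaceTransform_mul_I_eq_zero fun y ↦ (hcl (by simp)).trans hc

theorem exists_laplaceTransform_ofReal_ne_zero (hμ : μ ≠ 0) :
    ∃ x : ℝ, 0 < x ∧ laplaceTransform μ x ≠ 0 := by
  by_contra! hzero
  have hana : AnalyticAt ℂ (laplaceTransform μ) (1 : ℝ) :=
    (differentiableOn_laplaceTransform μ).analyticAt
      ((isOpen_lt continuous_const continuous_re).mem_nhds (by simp))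
  have hne : Tendsto ((↑) : ℝ → ℂ) (𝓝[≠] 1) (𝓝[≠] (1 : ℝ)) :=
    continuous_ofReal.continuousWithinAt.tendsto_nhdsWithin fun _ ↦ ofReal_injective.ne
  have hev : ∀ᶠ x : ℝ in 𝓝[≠] 1, laplaceTransform μ x = 0 :=
    nhdsWithin_le_nhds ((lt_mem_nhds one_pos).mono hzero)
  exact hμ (eq_zero_of_laplaceTransform_eventuallyEq_const (by simp)
    (hana.frequently_zero_iff_eventually_zero.1 (hne.frequently hev.frequently)))

theorem exists_pos_forall_norm_laplaceTransform_le (hμ : μ ≠ 0)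
    (h₀ : ∃ x : ℝ, 0 < x ∧ |μ univ| ≤ ‖laplaceTransform μ x‖) :
    ∃ x₀ : ℝ, 0 < x₀ ∧ laplaceTransform μ x₀ ≠ 0 ∧
      ∀ x : ℝ, 0 ≤ x → ‖laplaceTransform μ x‖ ≤ ‖laplaceTransform μ x₀‖ := by
  obtain ⟨x₁, hx₁, hne⟩ := exists_laplaceTransform_ofReal_ne_zero hμ
  have hcont : ContinuousOn (fun x : ℝ ↦ ‖laplaceTransform μ x‖) (Ici 0) :=
    ((continuousOn_laplaceTransform μ).comp continuous_ofReal.continuousOn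
      fun x hx ↦ by simpa using hx).norm
  have hlarge : ∀ᶠ x : ℝ in cocompact ℝ ⊓ 𝓟 (Ici 0),
      ‖laplaceTransform μ x‖ ≤ ‖laplaceTransform μ x₁‖ := by
    rw [eventually_inf_principal, cocompact_eq_atBot_atTop, eventually_sup]
    refine ⟨(eventually_lt_atBot 0).mono fun x hx hx' ↦ absurd hx' hx.not_ge, ?_⟩
    filter_upwards [(tendsto_laplaceTransform_atTop μ).norm.eventually
      (gt_mem_nhds (norm_zero.trans_lt (norm_pos_iff.2 hne)))] with x hx _ using hx.le
  obtain ⟨x₂, hx₂, hmax⟩ := hcont.exists_isMaxOn' isClosed_Ici hx₁.le hlarge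
  have hne₂ : laplaceTransform μ x₂ ≠ 0 :=
    norm_pos_iff.1 ((norm_pos_iff.2 hne).trans_le (hmax hx₁.le))
  rcases eq_or_lt_of_le (mem_Ici.1 hx₂) with rfl | hx₂
  · obtain ⟨x₃, hx₃, hle⟩ := h₀
    have hle' : ‖laplaceTransform μ (0 : ℝ)‖ ≤ ‖laplaceTransform μ x₃‖ := by
      simpa [laplaceTransform_zero] using hle
    exact ⟨x₃, hx₃, norm_pos_iff.1 ((norm_pos_iff.2 hne₂).trans_le hle'),
      fun x hx ↦ (hmax hx).trans hle'⟩
  · exact ⟨x₂, hx₂, hne₂, fun x hx ↦ hmax hx⟩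

theorem hasRealPeak_laplaceTransform_div (hμ : μ ≠ 0) {x₀ : ℝ} (hx₀ : 0 < x₀)
    (hne : laplaceTransform μ x₀ ≠ 0)
    (hmax : ∀ x : ℝ, 0 ≤ x → ‖laplaceTransform μ x‖ ≤ ‖laplaceTransform μ x₀‖) :
    HasRealPeak (fun z ↦ laplaceTransform μ z / laplaceTransform μ x₀) x₀ where
  differentiableOn := (differentiableOn_laplaceTransform μ).div_const _
  continuousOn := (continuousOn_laplaceTransform μ).div_const _
  exists_norm_le := ⟨μ.variation.real univ / ‖laplaceTransform μ x₀‖, fun z hz ↦ by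
    rw [norm_div]
    gcongr
    exact norm_laplaceTransform_le μ hz⟩
  map_conj z hz := by
    have hreal : conj (laplaceTransform μ x₀) = laplaceTransform μ x₀ := by
      rw [← laplaceTransform_conj μ (by simpa using hx₀.le), conj_ofReal]
    rw [laplaceTransform_conj μ hz, map_div₀, hreal]
  norm_le_one x hx := by
    rw [norm_div]
    exact div_le_one_of_le₀ (hmax x hx) (norm_nonneg _)
  pos := hx₀
  apply_eq_one := div_self hne
  not_eventually_eq_one h := hμ <| eq_zero_of_laplaceTransform_eventuallyEq_const
    (by simpa using hx₀) (h.mono fun _ ↦ eq_of_div_eq_one)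

end LaplaceTransform

section ExpTransform

open scoped FourierTransform

variable {E : Type*} [NormedAddCommGroup E]

/-- `f` decays on `(0, ∞)` faster than every exponential. -/
def HasSuperexponentialDecay (f : ℝ → E) : Prop :=
  ∀ ω : ℝ, ∃ C : ℝ, ∀ t : ℝ, 0 < t → ‖f t‖ ≤ C * Real.exp (-ω * t)

variable [NormedSpace ℂ E] {f : ℝ → E}

/-- The exponential transform `z ↦ ∫₀^∞ e^{zt} f(t) dt`, which is the Laplace transform of `f`
at `-z`; for an orbit `f t = T t x` of a semigroup it is the resolvent of the generator at `-z`,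
applied to `x`. -/
noncomputable def expTransform (f : ℝ → E) (z : ℂ) : E :=
  ∫ t in Ioi (0 : ℝ), exp (z * t) • f t

theorem HasSuperexponentialDecay.exists_forall_norm_exp_mul_smul_le
    (hf : HasSuperexponentialDecay f) (b : ℝ) :
    ∃ C : ℝ, ∀ z : ℂ, z.re ≤ b → ∀ t : ℝ, 0 < t →
      ‖exp (z * t) • f t‖ ≤ C * Real.exp (-1 * t) := by
  obtain ⟨C, hC⟩ := hf (b + 1)
  refine ⟨C, fun z hz t ht ↦ ?_⟩
  calc ‖exp (z * t) • f t‖ = Real.exp (z.re * t) * ‖f t‖ := by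
        rw [norm_smul, norm_exp, re_mul_ofReal]
    _ ≤ Real.exp (b * t) * (C * Real.exp (-(b + 1) * t)) := by
        gcongr
        exact hC t ht
    _ = C * Real.exp (-1 * t) := by
        rw [mul_left_comm, ← Real.exp_add]
        ring_nf

theorem HasSuperexponentialDecay.ofReal_smul (hf : HasSuperexponentialDecay f) :
    HasSuperexponentialDecay fun t ↦ (t : ℂ) • f t := by
  intro ω
  obtain ⟨C, hC⟩ := hf (ω + 1)
  refine ⟨C, fun t ht ↦ ?_⟩
  have ht_le : t ≤ Real.exp t := by linarith [Real.add_one_le_exp t]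
  calc ‖(t : ℂ) • f t‖ = t * ‖f t‖ := by rw [norm_smul, norm_real, Real.norm_of_nonneg ht.le]
    _ ≤ Real.exp t * (C * Real.exp (-(ω + 1) * t)) := by
        gcongr
        exact hC t ht
    _ = C * Real.exp (-ω * t) := by
        rw [mul_left_comm, ← Real.exp_add]
        ring_nf

theorem aestronglyMeasurable_exp_mul_smul
    (hfm : AEStronglyMeasurable f (volume.restrict (Ioi 0))) (z : ℂ) :
    AEStronglyMeasurable (fun t : ℝ ↦ exp (z * t) • f t) (volume.restrict (Ioi 0)) :=
  (by fun_prop : Continuous fun t : ℝ ↦ exp (z * t)).aestronglyMeasurable.smul hfm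

theorem HasSuperexponentialDecay.integrableOn_exp_mul_smul (hf : HasSuperexponentialDecay f)
    (hfm : AEStronglyMeasurable f (volume.restrict (Ioi 0))) (z : ℂ) :
    IntegrableOn (fun t : ℝ ↦ exp (z * t) • f t) (Ioi 0) := by
  obtain ⟨C, hC⟩ := hf.exists_forall_norm_exp_mul_smul_le z.re
  refine ((exp_neg_integrableOn_Ioi 0 one_pos).const_mul C).mono'
    (aestronglyMeasurable_exp_mul_smul hfm z) ?_
  filter_upwards [ae_restrict_mem measurableSet_Ioi] with t ht
  exact hC z le_rfl t ht

theorem HasSuperexponentialDecay.integrableOn (hf : HasSuperexponentialDecay f)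
    (hfm : AEStronglyMeasurable f (volume.restrict (Ioi 0))) : IntegrableOn f (Ioi 0) := by
  simpa using hf.integrableOn_exp_mul_smul hfm 0

theorem HasSuperexponentialDecay.differentiable_expTransform (hf : HasSuperexponentialDecay f)
    (hfm : AEStronglyMeasurable f (volume.restrict (Ioi 0))) :
    Differentiable ℂ (expTransform f) := by
  intro z₀
  obtain ⟨C, hC⟩ := hf.ofReal_smul.exists_forall_norm_exp_mul_smul_le (z₀.re + 1)
  have htm : AEStronglyMeasurable (fun t : ℝ ↦ (t : ℂ) • f t) (volume.restrict (Ioi 0)) :=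
    continuous_ofReal.aestronglyMeasurable.smul hfm
  refine (hasDerivAt_integral_of_dominated_loc_of_deriv_le
    (F' := fun z (t : ℝ) ↦ exp (z * t) • (t : ℂ) • f t)
    (bound := fun t ↦ C * Real.exp (-1 * t)) (ball_mem_nhds z₀ one_pos)
    (.of_forall (aestronglyMeasurable_exp_mul_smul hfm)) (hf.integrableOn_exp_mul_smul hfm z₀)
    (aestronglyMeasurable_exp_mul_smul htm z₀) ?_
    ((exp_neg_integrableOn_Ioi 0 one_pos).const_mul C) ?_).2.differentiableAt
  · filter_upwards [ae_restrict_mem measurableSet_Ioi] with t ht z hz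
    have hre : |z.re - z₀.re| ≤ 1 := (abs_re_le_norm (z - z₀)).trans (mem_ball_iff_norm.1 hz).le
    exact hC z (by linarith [(abs_le.1 hre).2]) t ht
  · refine .of_forall fun t z _ ↦ ?_
    simpa only [smul_smul, one_mul, id] using
      ((hasDerivAt_id z).mul_const (t : ℂ)).cexp.smul_const (f t)

theorem norm_exp_mul_smul_le {z : ℂ} (hz : z.re ≤ 0) {t : ℝ} (ht : 0 ≤ t) (v : E) :
    ‖exp (z * t) • v‖ ≤ ‖v‖ := by
  rw [norm_smul, norm_exp, re_mul_ofReal]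
  exact mul_le_of_le_one_left (norm_nonneg v)
    (Real.exp_le_one_iff.2 (mul_nonpos_of_nonpos_of_nonneg hz ht))

theorem norm_expTransform_le (hf : IntegrableOn f (Ioi 0)) {z : ℂ} (hz : z.re ≤ 0) :
    ‖expTransform f z‖ ≤ ∫ t in Ioi (0 : ℝ), ‖f t‖ := by
  refine norm_integral_le_of_norm_le hf.norm ?_
  filter_upwards [ae_restrict_mem measurableSet_Ioi] with t ht
  exact norm_exp_mul_smul_le hz (le_of_lt ht) (f t)

theorem tendsto_expTransform_neg_atTop (hf : IntegrableOn f (Ioi 0)) :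
    Tendsto (fun x : ℝ ↦ expTransform f (-x)) atTop (𝓝 0) := by
  rw [← integral_zero ℝ E (μ := volume.restrict (Ioi 0))]
  refine tendsto_integral_filter_of_dominated_convergence (fun t ↦ ‖f t‖)
    (.of_forall fun x ↦ aestronglyMeasurable_exp_mul_smul hf.aestronglyMeasurable (-x)) ?_
    hf.norm ?_
  · filter_upwards [eventually_ge_atTop 0] with x hx
    filter_upwards [ae_restrict_mem measurableSet_Ioi] with t ht
    exact norm_exp_mul_smul_le (by simpa using hx) (le_of_lt ht) (f t)
  · filter_upwards [ae_restrict_mem measurableSet_Ioi] with t ht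
    have hexp : Tendsto (fun x : ℝ ↦ exp (-x * t)) atTop (𝓝 0) := by
      rw [tendsto_exp_nhds_zero_iff]
      simpa using tendsto_id.atTop_mul_const (show (0 : ℝ) < t from ht)
    simpa using hexp.smul_const (f t)

theorem exp_mul_smul_expTransform_shift (f : ℝ → E) (z : ℂ) (a : ℝ) :
    exp (z * a) • expTransform (fun t ↦ f (t + a)) z = ∫ t in Ioi a, exp (z * t) • f t := by
  have hshift := (measurePreserving_add_right volume a).setIntegral_preimage_emb
    (measurableEmbedding_addRight a) (fun t : ℝ ↦ exp (z * t) • f t) (Ioi a)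
  rw [preimage_add_const_Ioi, sub_self] at hshift
  rw [← hshift, expTransform, ← integral_smul]
  congr with t
  rw [smul_smul, ← exp_add, ofReal_add, mul_add, add_comm]

theorem norm_exp_neg_mul_smul_expTransform_sub_shift_le (hf : HasSuperexponentialDecay f)
    (hfm : AEStronglyMeasurable f (volume.restrict (Ioi 0))) {z : ℂ} (hz : 0 ≤ z.re) {a : ℝ}
    (ha : 0 ≤ a) :
    ‖exp (-(z * a)) • expTransform f z - expTransform (fun t ↦ f (t + a)) z‖ ≤
      ∫ t in Ioi (0 : ℝ), ‖f t‖ := by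
  have hint := hf.integrableOn_exp_mul_smul hfm z
  have hsplit : exp (-(z * a)) • expTransform f z - expTransform (fun t ↦ f (t + a)) z =
      ∫ t in Ioc 0 a, exp (-(z * a)) • exp (z * t) • f t := by
    have hunion := setIntegral_union (Ioc_disjoint_Ioi le_rfl) measurableSet_Ioi
      (hint.mono_set Ioc_subset_Ioi_self) (hint.mono_set (Ioi_subset_Ioi ha))
    rw [Ioc_union_Ioi_eq_Ioi ha, ← exp_mul_smul_expTransform_shift f z a] at hunion
    rw [integral_smul, expTransform, hunion, smul_add, smul_smul (exp (-(z * a))), ← exp_add,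
      neg_add_cancel, exp_zero, one_smul, add_sub_cancel_right]
  have hnorm := (hf.integrableOn hfm).norm
  rw [hsplit]
  calc _ ≤ ∫ t in Ioc 0 a, ‖f t‖ := by
        refine norm_integral_le_of_norm_le (hnorm.mono_measure
          (Measure.restrict_mono Ioc_subset_Ioi_self le_rfl)) ?_
        filter_upwards [ae_restrict_mem measurableSet_Ioc] with t ht
        have hexp : exp (-(z * a)) • exp (z * t) • f t = exp (-z * (a - t : ℝ)) • f t := by
          rw [smul_smul, ← exp_add, ofReal_sub]
          ring_nf
        rw [hexp]
        exact norm_exp_mul_smul_le (by simpa using hz) (sub_nonneg.2 ht.2) (f t)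
    _ ≤ ∫ t in Ioi (0 : ℝ), ‖f t‖ :=
        setIntegral_mono_set hnorm (.of_forall fun _ ↦ norm_nonneg _)
          Ioc_subset_Ioi_self.eventuallyLE

theorem HasSuperexponentialDecay.expTransform_eq_zero_of_isBounded_range
    (hf : HasSuperexponentialDecay f)
    (hfm : AEStronglyMeasurable f (volume.restrict (Ioi 0)))
    (hbdd : Bornology.IsBounded (range (expTransform f))) (z : ℂ) : expTransform f z = 0 := by
  have hconst : ∀ w, expTransform f w = expTransform f z := fun w ↦
    (hf.differentiable_expTransform hfm).apply_eq_apply_of_bounded hbdd w z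
  have hlim := tendsto_expTransform_neg_atTop (hf.integrableOn hfm)
  simp only [hconst] at hlim
  exact tendsto_nhds_unique tendsto_const_nhds hlim

theorem eq_zero_of_expTransform_eq_zero [CompleteSpace E] (hf : IntegrableOn f (Ioi 0))
    (hzero : ∀ y : ℝ, expTransform f (y * I) = 0) {t : ℝ} (ht : 0 < t) (hft : ContinuousAt f t) :
    f t = 0 := by
  set g : ℝ → E := (Ioi 0).indicator f
  have hg : 𝓕 g = 0 := by
    funext w
    rw [Real.fourier_real_eq_integral_exp_smul, Pi.zero_apply, ← hzero (-2 * Real.pi * w),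
      expTransform, ← integral_indicator measurableSet_Ioi]
    congr with v
    by_cases hv : v ∈ Ioi (0 : ℝ)
    · simp only [g, indicator_of_mem hv]
      push_cast
      ring_nf
    · simp only [g, indicator_of_notMem hv, smul_zero]
  have hgt : g =ᶠ[𝓝 t] f := by
    filter_upwards [Ioi_mem_nhds ht] with v hv using indicator_of_mem hv f
  have hinv : 𝓕⁻ (𝓕 g) t = g t :=
    (hf.integrable_indicator measurableSet_Ioi).fourierInv_fourier_eq
    (by rw [hg]; exact integrable_zero ..) (hft.congr hgt.symm)
  simp only [← hgt.eq_of_nhds, ← hinv, hg, Real.fourierInv_eq, Pi.zero_apply, smul_zero,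
    integral_zero]

end ExpTransform

section Semigroup

theorem exists_forall_norm_pow_le_of_spectralRadius_lt {A : Type*} [NormedRing A]
    [NormedAlgebra ℂ A] [CompleteSpace A] {a : A} {q : ℝ}
    (ha : spectralRadius ℂ a < ENNReal.ofReal q) :
    ∃ C : ℝ, 0 < C ∧ ∀ n : ℕ, ‖a ^ n‖ ≤ C * q ^ n := by
  have hq : 0 < q := ENNReal.ofReal_pos.1 (bot_le.trans_lt ha)
  have hroot := (spectrum.pow_norm_pow_one_div_tendsto_nhds_spectralRadius a).eventually_lt_const ha
  have hO : (fun n ↦ a ^ n) =O[atTop] fun n ↦ q ^ n := by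
    refine .of_bound 1 ?_
    filter_upwards [hroot, eventually_ne_atTop 0] with n hn hn0
    have hle := (ENNReal.ofReal_lt_ofReal_iff hq).1 hn
    rw [one_mul, Real.norm_of_nonneg (by positivity)]
    calc ‖a ^ n‖ = (‖a ^ n‖ ^ (1 / n : ℝ)) ^ n := by
          rw [one_div, Real.rpow_inv_natCast_pow (norm_nonneg _) hn0]
      _ ≤ q ^ n := by gcongr
  obtain ⟨C, hC, hbound⟩ := Asymptotics.bound_of_isBigO_nat_atTop hO
  refine ⟨C, hC, fun n ↦ ?_⟩
  simpa only [norm_pow, Real.norm_of_nonneg hq.le] using hbound (pow_ne_zero n hq.ne')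

namespace IsStronglyContinuousSemigroup

variable {X : Type*} [NormedAddCommGroup X] [NormedSpace ℂ X] {T : ℝ → X →L[ℂ] X}

theorem nat_mul_add (hT : IsStronglyContinuousSemigroup T) {a t : ℝ} (ha : 0 < a) (ht : 0 < t)
    (n : ℕ) : T (n * a + t) = T a ^ n * T t := by
  induction n with
  | zero => simp
  | succ n ih =>
    have hsucc : ((n + 1 : ℕ) : ℝ) * a + t = a + (n * a + t) := by
      push_cast
      ring
    rw [hsucc, hT.map_add a _ ha (by positivity), ih, pow_succ', mul_assoc]

theorem exists_norm_le_Icc [CompleteSpace X] (hT : IsStronglyContinuousSemigroup T) {a b : ℝ}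
    (ha : 0 < a) : ∃ K : ℝ, ∀ t ∈ Icc a b, ‖T t‖ ≤ K := by
  obtain ⟨K, hK⟩ := banach_steinhaus (g := fun t : Icc a b ↦ T t) fun x ↦ by
    obtain ⟨C, hC⟩ := isCompact_Icc.exists_bound_of_continuousOn
      ((hT.continuousOn x).mono fun t (ht : t ∈ Icc a b) ↦ ha.trans_le ht.1)
    exact ⟨C, fun t ↦ hC t t.2⟩
  exact ⟨K, fun t ht ↦ hK ⟨t, ht⟩⟩

theorem exists_norm_le_exp_of_spectralRadius_lt [CompleteSpace X]
    (hT : IsStronglyContinuousSemigroup T) {a ω : ℝ} (ha : 0 < a)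
    (hω : spectralRadius ℂ (T a) < ENNReal.ofReal (Real.exp (ω * a))) :
    ∃ C : ℝ, ∀ t : ℝ, a ≤ t → ‖T t‖ ≤ C * Real.exp (ω * t) := by
  obtain ⟨K, hK⟩ := hT.exists_norm_le_Icc (b := 2 * a) ha
  obtain ⟨C, hC₀, hC⟩ := exists_forall_norm_pow_le_of_spectralRadius_lt hω
  refine ⟨C * K * Real.exp (|ω| * (2 * a)), fun t ht ↦ ?_⟩
  obtain ⟨n, u, hu, rfl⟩ : ∃ (n : ℕ) (u : ℝ), u ∈ Icc a (2 * a) ∧ t = n * a + u := by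
    have hfloor := Nat.floor_le (div_nonneg (sub_nonneg.2 ht) ha.le)
    have hlt := Nat.lt_floor_add_one ((t - a) / a)
    rw [le_div_iff₀ ha] at hfloor
    rw [div_lt_iff₀ ha] at hlt
    exact ⟨⌊(t - a) / a⌋₊, t - ⌊(t - a) / a⌋₊ * a, ⟨by linarith, by linarith⟩, by ring⟩
  have hu₀ : 0 < u := ha.trans_le hu.1
  have hexp : Real.exp (ω * a) ^ n ≤
      Real.exp (|ω| * (2 * a)) * Real.exp (ω * (n * a + u)) := by
    rw [← Real.exp_nat_mul, ← Real.exp_add, Real.exp_le_exp]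
    have : -ω * u ≤ |ω| * (2 * a) :=
      mul_le_mul (neg_le_abs ω) hu.2 hu₀.le (abs_nonneg ω)
    linarith
  have hK₀ : 0 ≤ K := (norm_nonneg _).trans (hK u hu)
  calc ‖T (n * a + u)‖ ≤ ‖T a ^ n‖ * ‖T u‖ := by
        rw [hT.nat_mul_add ha hu₀]
        exact norm_mul_le _ _
    _ ≤ C * Real.exp (ω * a) ^ n * K := by
        gcongr
        exacts [hC n, hK u hu]
    _ ≤ C * (Real.exp (|ω| * (2 * a)) * Real.exp (ω * (n * a + u))) * K := by gcongr
    _ = C * K * Real.exp (|ω| * (2 * a)) * Real.exp (ω * (n * a + u)) := by ring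

theorem exists_norm_le_exp [CompleteSpace X] (hT : IsStronglyContinuousSemigroup T)
    (hq : IsQuasinilpotentSemigroup T) {a : ℝ} (ha : 0 < a) (ω : ℝ) :
    ∃ C : ℝ, ∀ t : ℝ, a ≤ t → ‖T t‖ ≤ C * Real.exp (ω * t) :=
  hT.exists_norm_le_exp_of_spectralRadius_lt ha (by simp [hq a ha, Real.exp_pos])

theorem exists_norm_le [CompleteSpace X] (hT : IsStronglyContinuousSemigroup T)
    (hq : IsQuasinilpotentSemigroup T) {a : ℝ} (ha : 0 < a) :
    ∃ C : ℝ, ∀ t : ℝ, a ≤ t → ‖T t‖ ≤ C := by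
  simpa using hT.exists_norm_le_exp hq ha 0

theorem continuousOn_orbit (hT : IsStronglyContinuousSemigroup T) {a : ℝ} (ha : 0 < a) (x : X) :
    ContinuousOn (fun t ↦ T (t + a) x) (Ioi 0) :=
  (hT.continuousOn x).comp (by fun_prop) fun _ ht ↦ add_pos ht ha

theorem aestronglyMeasurable_orbit (hT : IsStronglyContinuousSemigroup T) {a : ℝ} (ha : 0 < a)
    (x : X) : AEStronglyMeasurable (fun t ↦ T (t + a) x) (volume.restrict (Ioi 0)) :=
  (hT.continuousOn_orbit ha x).aestronglyMeasurable measurableSet_Ioi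

theorem hasSuperexponentialDecay_orbit [CompleteSpace X] (hT : IsStronglyContinuousSemigroup T)
    (hq : IsQuasinilpotentSemigroup T) {a : ℝ} (ha : 0 < a) (x : X) :
    HasSuperexponentialDecay fun t ↦ T (t + a) x := by
  intro ω
  obtain ⟨C, hC⟩ := hT.exists_norm_le_exp hq ha (-ω)
  refine ⟨C * Real.exp (-ω * a) * ‖x‖, fun t ht ↦ ?_⟩
  calc ‖T (t + a) x‖ ≤ C * Real.exp (-ω * (t + a)) * ‖x‖ :=
        (T _).le_of_opNorm_le (hC _ (by linarith)) x
    _ = C * Real.exp (-ω * a) * ‖x‖ * Real.exp (-ω * t) := by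
        rw [mul_add, Real.exp_add]
        ring

theorem aestronglyMeasurable_comp_mul (hT : IsStronglyContinuousSemigroup T) {s : ℝ} (hs : 0 < s)
    (x : X) (ρ : Measure (Ioi (0 : ℝ))) :
    AEStronglyMeasurable (fun ξ : Ioi (0 : ℝ) ↦ T (s * ξ) x) ρ :=
  ((hT.continuousOn x).comp_continuous (by fun_prop)
    fun ξ ↦ mul_pos hs ξ.2).aestronglyMeasurable

theorem isFunctionalCalculusDefined_of_variation_eq_zero [CompleteSpace X]
    (hT : IsStronglyContinuousSemigroup T) (hq : IsQuasinilpotentSemigroup T)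
    {μ : SignedMeasure (Ioi (0 : ℝ))} {a : ℝ} (ha : 0 < a)
    (hμ : μ.variation {ξ : Ioi (0 : ℝ) | (ξ : ℝ) < a} = 0) {s : ℝ} (hs : 0 < s) :
    IsFunctionalCalculusDefined μ T s := by
  intro x
  obtain ⟨C, hC⟩ := hT.exists_norm_le hq (mul_pos hs ha)
  refine Integrable.of_bound (hT.aestronglyMeasurable_comp_mul hs x _) (C * ‖x‖) ?_
  filter_upwards [measure_eq_zero_iff_ae_notMem.1 hμ] with ξ hξ
  exact (T _).le_of_opNorm_le (hC _ (mul_le_mul_of_nonneg_left (not_lt.1 hξ) hs.le)) x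

theorem isFunctionalCalculusDefined_of_norm_le [CompleteSpace X]
    (hT : IsStronglyContinuousSemigroup T) (hq : IsQuasinilpotentSemigroup T)
    (μ : SignedMeasure (Ioi (0 : ℝ))) {a C : ℝ} (ha : 0 < a)
    (hC : ∀ t : ℝ, 0 < t → t < a → ‖T t‖ ≤ C) {s : ℝ} (hs : 0 < s) :
    IsFunctionalCalculusDefined μ T s := by
  intro x
  obtain ⟨C', hC'⟩ := hT.exists_norm_le hq ha
  refine Integrable.of_bound (hT.aestronglyMeasurable_comp_mul hs x _) (max C C' * ‖x‖)
    (.of_forall fun ξ ↦ (T _).le_of_opNorm_le ?_ x)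
  rcases lt_or_ge (s * (ξ : ℝ)) a with hlt | hge
  · exact (hC _ (mul_pos hs ξ.2) hlt).trans (le_max_left _ _)
  · exact (hC' _ hge).trans (le_max_right _ _)

theorem apply_expTransform_orbit [CompleteSpace X] (hT : IsStronglyContinuousSemigroup T)
    (hq : IsQuasinilpotentSemigroup T) {a b : ℝ} (ha : 0 < a) (hb : 0 < b) (x : X) (z : ℂ) :
    T b (expTransform (fun t ↦ T (t + a) x) z) = expTransform (fun t ↦ T (t + b + a) x) z := by
  rw [expTransform, ← (T b).integral_comp_comm ((hT.hasSuperexponentialDecay_orbit hq ha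
    x).integrableOn_exp_mul_smul (hT.aestronglyMeasurable_orbit ha x) z)]
  refine setIntegral_congr_fun measurableSet_Ioi fun t ht ↦ ?_
  have hadd : t + b + a = b + (t + a) := by ring
  simp only [map_smul, hadd, hT.map_add b (t + a) hb (add_pos ht ha), mul_apply_eq_comp]

end IsStronglyContinuousSemigroup

end Semigroup

section FunctionalCalculus

theorem exists_clm_ae_eq_of_integrable {𝕜 Ω X Y : Type*} [NontriviallyNormedField 𝕜]
    [MeasurableSpace Ω] {ρ : Measure Ω} [NormedAddCommGroup X] [NormedSpace 𝕜 X] [CompleteSpace X]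
    [NormedAddCommGroup Y] [NormedSpace 𝕜 Y] [CompleteSpace Y] {A : Ω → X →L[𝕜] Y}
    (hA : ∀ x, Integrable (fun ω ↦ A ω x) ρ) :
    ∃ B : X →L[𝕜] (Ω →₁[ρ] Y), ∀ x, B x =ᵐ[ρ] fun ω ↦ A ω x := by
  let B : X →ₗ[𝕜] (Ω →₁[ρ] Y) :=
    { toFun := fun x ↦ (hA x).toL1 _
      map_add' := fun x y ↦ by
        simp only [map_add]
        exact Integrable.toL1_add _ _ (hA x) (hA y)
      map_smul' := fun c x ↦ by
        simp only [map_smul]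
        exact Integrable.toL1_smul' _ (hA x) c }
  have hB : ∀ x, B x =ᵐ[ρ] fun ω ↦ A ω x := fun x ↦ (hA x).coeFn_toL1
  refine ⟨.ofSeqClosedGraph (g := B) fun u x y hu hy ↦ ?_, hB⟩
  obtain ⟨k, hk, hae⟩ := (tendstoInMeasure_of_tendsto_Lp hy).exists_seq_tendsto_ae
  refine Lp.ext ?_
  filter_upwards [hae, ae_all_iff.2 fun n ↦ hB (u n), hB x] with ω hlim hu_eq hx_eq
  have hcont : Tendsto (fun n ↦ A ω (u (k n))) atTop (𝓝 (A ω x)) :=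
    ((A ω).continuous.tendsto x).comp (hu.comp hk.tendsto_atTop)
  rw [hx_eq]
  exact tendsto_nhds_unique hlim (hcont.congr fun n ↦ (hu_eq (k n)).symm)

theorem exists_clm_eq_integral {𝕜 Ω X Y : Type*} [RCLike 𝕜] [MeasurableSpace Ω] {ρ : Measure Ω}
    [NormedAddCommGroup X] [NormedSpace 𝕜 X] [CompleteSpace X] [NormedAddCommGroup Y]
    [NormedSpace ℝ Y] [NormedSpace 𝕜 Y] [CompleteSpace Y] {A : Ω → X →L[𝕜] Y}
    (hA : ∀ x, Integrable (fun ω ↦ A ω x) ρ) :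
    ∃ B : X →L[𝕜] Y, ∀ x, B x = ∫ ω, A ω x ∂ρ := by
  obtain ⟨B, hB⟩ := exists_clm_ae_eq_of_integrable hA
  refine ⟨(L1.integralCLM' 𝕜).comp B, fun x ↦ ?_⟩
  rw [← integral_congr_ae (hB x)]
  exact (L1.integral_eq' 𝕜 (B x)).symm.trans (L1.integral_eq_integral (B x))

variable {X : Type*} [NormedAddCommGroup X] [NormedSpace ℂ X] [CompleteSpace X]
  {μ : SignedMeasure (Ioi (0 : ℝ))} {T : ℝ → X →L[ℂ] X} {s : ℝ}

theorem exists_clm_eq_functionalCalculus (h : IsFunctionalCalculusDefined μ T s) :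
    ∃ B : X →L[ℂ] X, ∀ x, B x = functionalCalculus μ T s x := by
  obtain ⟨P, hP⟩ := exists_clm_eq_integral fun x ↦ (integrable_posPart_and_negPart (h x)).1
  obtain ⟨N, hN⟩ := exists_clm_eq_integral fun x ↦ (integrable_posPart_and_negPart (h x)).2
  refine ⟨P - N, fun x ↦ ?_⟩
  rw [sub_apply, hP, hN, functionalCalculus, integral_signedMeasure_eq_sub (h x)]

theorem laplaceTransform_smul_eq_integral (μ : SignedMeasure (Ioi (0 : ℝ))) {z : ℂ}
    (hz : 0 ≤ z.re) (x : X) :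
    laplaceTransform μ z • x = ∫ᵛ ξ : Ioi (0 : ℝ), exp (-(z * (ξ : ℝ))) • x ∂<•μ :=
  map_integral_signedMeasure ((ContinuousLinearMap.toSpanSingleton ℂ x).restrictScalars ℝ)
    (integrable_exp_neg_mul μ.variation hz)

namespace IsStronglyContinuousSemigroup

theorem norm_laplaceTransform_smul_sub_functionalCalculus_le
    (hT : IsStronglyContinuousSemigroup T) (hq : IsQuasinilpotentSemigroup T) {a : ℝ} (ha : 0 < a)
    (x : X) (hs : 0 < s) (h : IsFunctionalCalculusDefined μ T s) {z : ℂ} (hz : 0 ≤ z.re) :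
    ‖laplaceTransform μ (s * z) • expTransform (fun t ↦ T (t + a) x) z -
      functionalCalculus μ T s (expTransform (fun t ↦ T (t + a) x) z)‖ ≤
    (∫ t in Ioi (0 : ℝ), ‖T (t + a) x‖) * μ.variation.real univ := by
  set J : X := expTransform (fun t ↦ T (t + a) x) z
  have hsz : 0 ≤ (s * z).re := by
    rw [re_ofReal_mul]
    positivity
  have hint : μ.Integrable fun ξ : Ioi (0 : ℝ) ↦ exp (-(s * z * (ξ : ℝ))) • J :=
    (integrable_exp_neg_mul μ.variation hsz).smul_const J
  rw [laplaceTransform_smul_eq_integral μ hsz, functionalCalculus,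
    ← VectorMeasure.integral_fun_sub hint (h J)]
  refine norm_integral_signedMeasure_le fun ξ ↦ ?_
  have hξ : 0 < s * (ξ : ℝ) := mul_pos hs ξ.2
  have hcomm : exp (-(s * z * (ξ : ℝ))) = exp (-(z * (s * ξ : ℝ))) := by
    push_cast
    ring_nf
  rw [hcomm, hT.apply_expTransform_orbit hq ha hξ]
  exact norm_exp_neg_mul_smul_expTransform_sub_shift_le
    (hT.hasSuperexponentialDecay_orbit hq ha x) (hT.aestronglyMeasurable_orbit ha x) hz hξ.le

theorem norm_expTransform_orbit_mul_sub_le (hT : IsStronglyContinuousSemigroup T)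
    (hq : IsQuasinilpotentSemigroup T) {a : ℝ} (ha : 0 < a) (x : X) (hs : 0 < s)
    (h : IsFunctionalCalculusDefined μ T s) {M : ℝ}
    (hM : ∀ v, ‖functionalCalculus μ T s v‖ ≤ M * ‖v‖) {z : ℂ} (hz : 0 ≤ z.re) :
    ‖expTransform (fun t ↦ T (t + a) x) z‖ * (‖laplaceTransform μ (s * z)‖ - M) ≤
      (∫ t in Ioi (0 : ℝ), ‖T (t + a) x‖) * μ.variation.real univ := by
  have hdiff := (norm_sub_norm_le _ _).trans
    (hT.norm_laplaceTransform_smul_sub_functionalCalculus_le hq ha x hs h hz)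
  rw [norm_smul] at hdiff
  linarith [hM (expTransform (fun t ↦ T (t + a) x) z)]

theorem isBounded_range_expTransform_orbit (hT : IsStronglyContinuousSemigroup T)
    (hq : IsQuasinilpotentSemigroup T) {a : ℝ} (ha : 0 < a) (x : X) {x₀ : ℝ}
    (hne : laplaceTransform μ x₀ ≠ 0)
    (hpeak : HasRealPeak (fun z ↦ laplaceTransform μ z / laplaceTransform μ x₀) x₀)
    (hfreq : ∃ᶠ s in 𝓝[>] 0, IsFunctionalCalculusDefined μ T s ∧
      ∀ v, ‖functionalCalculus μ T s v‖ ≤ ‖laplaceTransform μ x₀‖ * ‖v‖) :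
    Bornology.IsBounded (range (expTransform fun t ↦ T (t + a) x)) := by
  have hdecay := hT.hasSuperexponentialDecay_orbit hq ha x
  have hmeas := hT.aestronglyMeasurable_orbit ha x
  set L : ℝ := ∫ t in Ioi (0 : ℝ), ‖T (t + a) x‖
  set M : ℝ := ‖laplaceTransform μ x₀‖
  have hM : 0 < M := norm_pos_iff.2 hne
  have hleft : ∀ z : ℂ, z.re ≤ 0 → ‖expTransform (fun t ↦ T (t + a) x) z‖ ≤ L := fun z ↦
    norm_expTransform_le (hdecay.integrableOn hmeas)
  obtain ⟨C, hright⟩ := hpeak.exists_forall_norm_le_of_frequently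
    (hdecay.differentiable_expTransform hmeas) (B := max L (L * μ.variation.real univ / M))
    (fun z hz ↦ (hleft z hz.le).trans (le_max_left _ _)) <| by
      refine (hfreq.and_eventually self_mem_nhdsWithin).mono fun s ⟨⟨h, hnorm⟩, hs⟩ z hz ↦
        le_max_of_le_right ?_
      rw [norm_div, ← div_self hM.ne', ← sub_div, ← mul_div_assoc]
      exact div_le_div_of_nonneg_right
        (hT.norm_expTransform_orbit_mul_sub_le hq ha x hs h hnorm hz) hM.le
  refine isBounded_iff_forall_norm_le.2 ⟨max L C, ?_⟩
  rintro _ ⟨z, rfl⟩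
  rcases le_or_gt z.re 0 with hz | hz
  exacts [le_max_of_le_left (hleft z hz), le_max_of_le_right (hright z hz)]

theorem eq_zero_of_isBounded_range_expTransform (hT : IsStronglyContinuousSemigroup T)
    (hq : IsQuasinilpotentSemigroup T)
    (hbdd : ∀ a, 0 < a → ∀ x,
      Bornology.IsBounded (range (expTransform fun t ↦ T (t + a) x)))
    {t : ℝ} (ht : 0 < t) : T t = 0 := by
  ext x
  have ht₂ : 0 < t / 2 := half_pos ht
  have hdecay := hT.hasSuperexponentialDecay_orbit hq ht₂ x
  have hmeas := hT.aestronglyMeasurable_orbit ht₂ x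
  have hzero := eq_zero_of_expTransform_eq_zero (hdecay.integrableOn hmeas)
    (fun y ↦ hdecay.expTransform_eq_zero_of_isBounded_range hmeas (hbdd _ ht₂ x) _) ht₂
    ((hT.continuousOn_orbit ht₂ x).continuousAt (Ioi_mem_nhds ht₂))
  simpa only [add_halves, zero_apply] using hzero

theorem eventually_exists_lt_norm_functionalCalculus (hT : IsStronglyContinuousSemigroup T)
    (hq : IsQuasinilpotentSemigroup T) (hT₀ : ∃ t : ℝ, 0 < t ∧ T t ≠ 0) {x₀ : ℝ}
    (hne : laplaceTransform μ x₀ ≠ 0)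
    (hpeak : HasRealPeak (fun z ↦ laplaceTransform μ z / laplaceTransform μ x₀) x₀) :
    ∀ᶠ s in 𝓝[>] 0, IsFunctionalCalculusDefined μ T s →
      ∃ v, ‖laplaceTransform μ x₀‖ * ‖v‖ < ‖functionalCalculus μ T s v‖ := by
  by_contra hcon
  obtain ⟨t, ht, hTt⟩ := hT₀
  refine hTt (hT.eq_zero_of_isBounded_range_expTransform hq (fun a ha x ↦ ?_) ht)
  refine hT.isBounded_range_expTransform_orbit hq ha x hne hpeak ?_
  simpa only [not_eventually, Classical.not_imp, not_exists, not_lt] using hcon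

end IsStronglyContinuousSemigroup

end FunctionalCalculus

theorem theorem3p1_general {X : Type*} [NormedAddCommGroup X] [NormedSpace ℂ X] [CompleteSpace X]
    (μ : SignedMeasure (Ioi (0 : ℝ))) (hμ : μ ≠ 0)
    (hμ_univ : ∃ x : ℝ, 0 < x ∧ |μ univ| ≤ ‖laplaceTransform μ x‖)
    (T : ℝ → X →L[ℂ] X) (hT : IsStronglyContinuousSemigroup T)
    (hT_quasinilpotent : IsQuasinilpotentSemigroup T) (hT_nontrivial : ∃ t : ℝ, 0 < t ∧ T t ≠ 0) :
    (((∃ a : ℝ, 0 < a ∧ μ.variation {ξ : Ioi (0 : ℝ) | (ξ : ℝ) < a} = 0) ∨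
        (∃ a C : ℝ, 0 < a ∧ ∀ t : ℝ, 0 < t → t < a → ‖T t‖ ≤ C)) →
      ∀ s : ℝ, 0 < s → IsFunctionalCalculusDefined μ T s) ∧
    ∃ M : ℝ, IsGreatest ((fun x : ℝ ↦ ‖laplaceTransform μ (x : ℂ)‖) '' Ici 0) M ∧
      ∃ η : ℝ, 0 < η ∧ ∀ s : ℝ, 0 < s → s ≤ η → IsFunctionalCalculusDefined μ T s →
        ∃ B : X →L[ℂ] X, (∀ x : X, B x = functionalCalculus μ T s x) ∧ M < ‖B‖ := by
  constructor
  · rintro (⟨a, ha, hvanish⟩ | ⟨a, C, ha, hbound⟩) s hs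
    · exact hT.isFunctionalCalculusDefined_of_variation_eq_zero hT_quasinilpotent ha hvanish hs
    · exact hT.isFunctionalCalculusDefined_of_norm_le hT_quasinilpotent μ ha hbound hs
  obtain ⟨x₀, hx₀, hne, hmax⟩ := exists_pos_forall_norm_laplaceTransform_le hμ hμ_univ
  refine ⟨‖laplaceTransform μ x₀‖, ⟨⟨x₀, hx₀.le, rfl⟩, forall_mem_image.2 hmax⟩, ?_⟩
  obtain ⟨η, hη, hlt⟩ := mem_nhdsGT_iff_exists_Ioc_subset.1 <|
    hT.eventually_exists_lt_norm_functionalCalculus hT_quasinilpotent hT_nontrivial hne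
      (hasRealPeak_laplaceTransform_div hμ hx₀ hne hmax)
  refine ⟨η, hη, fun s hs hsη hdef ↦ ?_⟩
  obtain ⟨B, hB⟩ := exists_clm_eq_functionalCalculus hdef
  obtain ⟨v, hv⟩ := hlt ⟨hs, hsη⟩ hdef
  rw [← hB v] at hv
  exact ⟨B, hB, lt_of_mul_lt_mul_right (hv.trans_le (B.le_opNorm v)) (norm_nonneg v)⟩

theorem theorem3p1 {X : Type*} [NormedAddCommGroup X] [NormedSpace ℂ X] [CompleteSpace X]
    (μ : SignedMeasure (Ioi (0 : ℝ))) (hμ : μ ≠ 0) (hμ_total : μ univ = 0)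
    (T : ℝ → X →L[ℂ] X) (hT : IsStronglyContinuousSemigroup T)
    (hT_quasinilpotent : IsQuasinilpotentSemigroup T) (hT_nontrivial : ∃ t : ℝ, 0 < t ∧ T t ≠ 0) :
    -- `F(-sA)` exists for all `s > 0` if `μ` vanishes near `0` or `T` is bounded near `0`
    (((∃ a : ℝ, 0 < a ∧ μ.variation {ξ : Ioi (0 : ℝ) | (ξ : ℝ) < a} = 0) ∨
        (∃ a C : ℝ, 0 < a ∧ ∀ t : ℝ, 0 < t → t < a → ‖T t‖ ≤ C)) →
      ∀ s : ℝ, 0 < s → IsFunctionalCalculusDefined μ T s) ∧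
    -- `M` is the maximum of `|F|` on `[0, ∞)`, and `B = F(-sA)`
    ∃ M : ℝ, IsGreatest ((fun x : ℝ => ‖laplaceTransform μ (x : ℂ)‖) '' Ici 0) M ∧
      ∃ η : ℝ, 0 < η ∧ ∀ s : ℝ, 0 < s → s ≤ η → IsFunctionalCalculusDefined μ T s →
        ∃ B : X →L[ℂ] X, (∀ x : X, B x = functionalCalculus μ T s x) ∧ M < ‖B‖ :=
  theorem3p1_general μ hμ ⟨1, one_pos, by simp [hμ_total]⟩ T hT hT_quasinilpotent
    hT_nontrivial
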